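/- Let $K\ge 2$ and $1\le m<K$. For each $k\in[K]=\{1,\dots,K\}$ let $f_0^k,f_1^k$ be two probability densities with respect to a $\sigma$-finite measure $\mu^k$ on a measurable space $\mathcal X^k$. For $A\subset[K]$ let $\mathbb P_A$ be the law under which the streams $(X_t^k)_{t\ge1}$, $k\in[K]$, are independent and the $k$-th stream is i.i.d. with density $f_1^k$ if $k\in A$ and $f_0^k$ if $k\notin A$; write $\mathbb E_A$ for the corresponding expectation. Assume that for every $k$ and $(i,i')\in\{(0,1),(1,0)\}$ $$\int \log\Bigl(\frac{f_i^k}{f_{i'}^k}\Bigr) f_i^k\,d\mu^k>0,\qquad \int \Bigl[\log\Bigl(\frac{f_i^k}{f_{i'}^k}\Bigr)\Bigr]^2 f_i^k\,d\mu^k<\infty ,$$ where $\log(a/0)=\infty$ for $a>0$. Let $\mathcal A=\{A\subset[K]:|A|=m\}$ and $\mathcal F_t=\sigma(X_s^k: s\le t,\ k\in[K])$. A procedure is a pair $(T,D)$ of an $\{\mathcal F_t\}$-stopping time $T\in\{1,2,\dots\}\cup\{\infty\}$ and an $\mathcal F_T$-measurable decision $D\in\mathcal A$. For $\alpha\in(0,1)$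 let $\Delta_m^{\mathrm{kns}}(\alpha)$ be the class of procedures with $\max_{A\in\mathcal A}\mathbb P_A(D\ne A)\le\alpha$, and let $T_A^{\min}(\Delta_m^{\mathrm{kns}}(\alpha))=\inf_{(T,D)\in\Delta_m^{\mathrm{kns}}(\alpha)}\mathbb E_A[T]$. Let $\lambda_t^k=\sum_{s=1}^t\log\bigl(f_1^k(X_s^k)/f_0^k(X_s^k)\bigr)$, with increasing order statistics $\bar\lambda_t^{(1)}\le\dots\le\bar\lambda_t^{(K)}$ over $k\in[K]$. The Gap rule $\delta_G(b)=(T_G(b),D_G(b))$ with threshold $b$ stops at $$T_G(b)=\min\{t\ge1:\ \bar\lambda_t^{(K-m+1)}-\bar\lambda_t^{(K-m)}\ge b\}$$ ($T_G(b)=\infty$ if there is no such $t$), and $D_G(b)$ is the set of the $m$ streams with the largest values $\lambda_{T_G(b)}^k$. Put $b_\alpha=|\log\alpha|+\log[m(K-m)]$. Then $\{\delta_G(b_\alpha)\}$ is second-order asymptotically optimal in $\{\Delta_m^{\mathrm{kns}}(\alpha)\}$: for every $\alpha\in(0,1)$, $\delta_G(b_\alpha)\in\Delta_m^{\mathrm{kns}}(\alpha)$;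 and for every $A\in\mathcal A$, $\mathbb E_A[T_G(b_\alpha)]<\infty$ for every $\alpha\in(0,1)$ and $$\limsup_{\alpha\downarrow0}\Bigl(\mathbb E_A[T_G(b_\alpha)]-T_A^{\min}\bigl(\Delta_m^{\mathrm{kns}}(\alpha)\bigr)\Bigr)<\infty .$$ -/

import Mathlib

open MeasureTheory Filter Topology
open scoped ENNReal NNReal

namespace SeqTest

/-- The data of `K` simple-versus-simple testing problems. Stream `k` takes values in `𝒳 k`, has a
`σ`-finite dominating measure `μ k`, and `f k i` is the density under the hypothesis `H_i`
(`i = 0`: null, `i = 1`: alternative). -/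
structure Streams (K : ℕ) (𝒳 : Fin K → Type*) [∀ k, MeasurableSpace (𝒳 k)] where
  μ : (k : Fin K) → Measure (𝒳 k)
  sigmaFinite : ∀ k, SigmaFinite (μ k)
  f : (k : Fin K) → Fin 2 → 𝒳 k → ℝ≥0
  measurable_f : ∀ k i, Measurable (f k i)
  lintegral_f : ∀ k i, ∫⁻ x, (f k i x : ℝ≥0∞) ∂(μ k) = 1

/-- The sample space of all streams: `ω k s` is the observation of stream `k` at time `s + 1`. -/
abbrev Path {K : ℕ} (𝒳 : Fin K → Type*) : Type _ := (k : Fin K) → ℕ → 𝒳 k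

/-- The vector of the observations across all streams at time `s + 1`. -/
def obs {K : ℕ} {𝒳 : Fin K → Type*} (s : ℕ) (ω : Path 𝒳) : (k : Fin K) → 𝒳 k := fun k => ω k s

section Model

variable {K : ℕ} {𝒳 : Fin K → Type*} [∀ k, MeasurableSpace (𝒳 k)]

theorem measurable_obs (s : ℕ) : Measurable (obs (𝒳 := 𝒳) s) :=
  measurable_pi_lambda _ fun k => (measurable_pi_apply s).comp (measurable_pi_apply k)

/-- The law of one observation of stream `k` under `H_i`. -/
noncomputable def obsLaw (S : Streams K 𝒳) (k : Fin K) (i : Fin 2) : Measure (𝒳 k) :=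
  (S.μ k).withDensity fun x => (S.f k i x : ℝ≥0∞)

instance instObsLawProb (S : Streams K 𝒳) (k : Fin K) (i : Fin 2) :
    IsProbabilityMeasure (obsLaw S k i) :=
  ⟨by rw [obsLaw, withDensity_apply _ MeasurableSet.univ, Measure.restrict_univ, S.lintegral_f]⟩

/-- The law of the i.i.d. data stream `k` under `H_i`. -/
noncomputable def streamLaw (S : Streams K 𝒳) (k : Fin K) (i : Fin 2) : Measure (ℕ → 𝒳 k) :=
  Measure.infinitePi fun _ : ℕ => obsLaw S k i

/-- The joint law of the independent streams when the signal subset is `A`. -/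
noncomputable def jointLaw (S : Streams K 𝒳) (A : Finset (Fin K)) : Measure (Path 𝒳) :=
  Measure.pi fun k => streamLaw S k (if k ∈ A then 1 else 0)

/-- `F_t`, generated by the observations of all the streams at times `1, …, t`. -/
def obsFiltration (𝒳 : Fin K → Type*) [∀ k, MeasurableSpace (𝒳 k)] :
    Filtration ℕ (MeasurableSpace.pi : MeasurableSpace (Path 𝒳)) where
  seq t := ⨆ s : {s : ℕ // s < t}, MeasurableSpace.comap (obs (𝒳 := 𝒳) s) inferInstance
  mono' := fun _ _ h =>
    iSup_le fun s => le_iSup (fun s : {s : ℕ // s < _} =>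
      MeasurableSpace.comap (obs (𝒳 := 𝒳) s) inferInstance) ⟨s, lt_of_lt_of_le s.2 h⟩
  le' := fun _ => iSup_le fun s => (measurable_obs (𝒳 := 𝒳) s).comap_le

/-- The Kullback-Leibler divergences between the two densities of every stream are positive, and
the log-likelihood ratio has a finite second moment under both hypotheses. The logarithm in the
second moment is extended-valued, so that `log (a / 0) = ∞` for `a > 0`; the second condition makes
the set where this happens `f k i`-null, so that the real logarithm is adequate in the first. -/
def KLPosSecondMoment (S : Streams K 𝒳) : Prop :=
  ∀ (k : Fin K) (i i' : Fin 2), i ≠ i' →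
    0 < ∫ x, Real.log ((S.f k i x : ℝ) / (S.f k i' x : ℝ)) * (S.f k i x : ℝ) ∂(S.μ k) ∧
    ∫⁻ x, (ENNReal.log ((S.f k i x : ℝ≥0∞) / (S.f k i' x : ℝ≥0∞))).abs ^ 2
      * (S.f k i x : ℝ≥0∞) ∂(S.μ k) < ∞

/-- A sequential multiple testing procedure with decisions in `𝒜`: a stopping time `T` (possibly
infinite) and an `F_T`-measurable decision `D`, the set of the streams declared to be signals. -/
structure Procedure (𝒳 : Fin K → Type*) [∀ k, MeasurableSpace (𝒳 k)]
    (𝒜 : Set (Finset (Fin K))) where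
  T : Path 𝒳 → ℕ∞
  D : Path 𝒳 → Finset (Fin K)
  one_le_T : ∀ ω, 1 ≤ T ω
  isStoppingTime_T : IsStoppingTime (obsFiltration 𝒳) T
  measurable_D : ∀ B, MeasurableSet[isStoppingTime_T.measurableSpace] {ω | D ω = B}
  D_mem : ∀ ω, D ω ∈ 𝒜

/-- The expected sample size `E_A[T]`. -/
noncomputable def ESS (S : Streams K 𝒳) {𝒜 : Set (Finset (Fin K))} (A : Finset (Fin K))
    (δ : Procedure 𝒳 𝒜) : ℝ≥0∞ :=
  ∫⁻ ω, (δ.T ω : ℝ≥0∞) ∂(jointLaw S A)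

/-- The minimal achievable expected sample size over a class of procedures. -/
noncomputable def minESS (S : Streams K 𝒳) {𝒜 : Set (Finset (Fin K))} (A : Finset (Fin K))
    (Δ : Set (Procedure 𝒳 𝒜)) : ℝ≥0∞ :=
  ⨅ δ ∈ Δ, ESS S A δ

/-- Second-order asymptotic optimality as the tolerance level `α` tends to `0`: every member of the
family belongs to its class and, for every possible signal subset, has a finite expected sample size
(so that the difference is not of the form `∞ - ∞`) whose excess over the minimum has a finite upper
limit. -/
def SecondOrderOptimal (S : Streams K 𝒳) {𝒜 : Set (Finset (Fin K))}
    (δ : ℝ → Procedure 𝒳 𝒜) (Δ : ℝ → Set (Procedure 𝒳 𝒜)) : Prop :=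
  (∀ α ∈ Set.Ioo (0 : ℝ) 1, δ α ∈ Δ α) ∧
  ∀ A ∈ 𝒜,
    (∀ α ∈ Set.Ioo (0 : ℝ) 1, ESS S A (δ α) < ∞) ∧
    limsup (fun α : ℝ => ((ESS S A (δ α) : EReal) - (minESS S A (Δ α) : EReal))) (𝓝[>] (0 : ℝ)) < ⊤

/-- The possible signal subsets when the number of signals is known to be `m`. -/
def knownNumber (K m : ℕ) : Set (Finset (Fin K)) := {A | A.card = m}

/-- Procedures whose probability of a wrong decision is at most `α` for every signal subset
of size `m`. -/
def knsClass (S : Streams K 𝒳) (m : ℕ) (α : ℝ) : Set (Procedure 𝒳 (knownNumber K m)) :=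
  {δ | ∀ A ∈ knownNumber K m, jointLaw S A {ω | δ.D ω ≠ A} ≤ ENNReal.ofReal α}

/-- The log-likelihood ratio statistic of stream `k` based on the first `t` observations. -/
noncomputable def LLR (S : Streams K 𝒳) (t : ℕ) (ω : Path 𝒳) (k : Fin K) : ℝ :=
  ∑ s ∈ Finset.range t, Real.log ((S.f k 1 (ω k s) : ℝ) / (S.f k 0 (ω k s) : ℝ))

end Model

/-- For the increasing rearrangement `v₍₁₎ ≤ … ≤ v₍K₎` of `v`, the gap `v₍K-m+1₎ - v₍K-m₎`.
The permutation `Tuple.sort v` lists the indices in increasing order of the values, counting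
positions from `0`. -/
noncomputable def gap {K m : ℕ} (hm : 1 ≤ m) (hmK : m < K) (v : Fin K → ℝ) : ℝ :=
  v (Tuple.sort v ⟨K - m, by omega⟩) - v (Tuple.sort v ⟨K - m - 1, by omega⟩)

/-- The set of the indices of the `m` largest entries of `v`, namely those in the positions
`K-m+1, …, K` of the increasing rearrangement. -/
noncomputable def topSet {K m : ℕ} (hm : 1 ≤ m) (hmK : m < K) (v : Fin K → ℝ) :
    Finset (Fin K) :=
  (Finset.Ici (⟨K - m, by omega⟩ : Fin K)).map (Tuple.sort v).toEmbedding

theorem card_topSet {K m : ℕ} (hm : 1 ≤ m) (hmK : m < K) (v : Fin K → ℝ) :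
    (topSet hm hmK v).card = m := by
  rw [topSet, Finset.card_map, Fin.card_Ici]
  show K - (K - m) = m
  omega

theorem measurableSet_sort_eq {K : ℕ} (σ : Equiv.Perm (Fin K)) :
    MeasurableSet {v : Fin K → ℝ | Tuple.sort v = σ} := by
  have h : {v : Fin K → ℝ | Tuple.sort v = σ}
      = (⋂ (i : Fin K) (j : Fin K) (_ : i ≤ j), {v | v (σ i) ≤ v (σ j)}) ∩
        ⋂ (i : Fin K) (j : Fin K) (_ : i < j) (_ : ¬ σ i < σ j), {v | v (σ i) = v (σ j)}ᶜ := by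
    ext v
    simp only [Set.mem_ofPred_eq, Set.mem_inter_iff, Set.mem_iInter, Set.mem_compl_iff]
    rw [eq_comm, Tuple.eq_sort_iff]
    refine and_congr Iff.rfl ?_
    exact forall_congr' fun i => forall_congr' fun j => forall_congr' fun _ =>
      ⟨fun h h1 h2 => h1 (h h2), fun h h2 => by_contra fun h1 => h h1 h2⟩
  rw [h]
  refine MeasurableSet.inter ?_ ?_
  · exact MeasurableSet.iInter fun i => MeasurableSet.iInter fun j => MeasurableSet.iInter fun _ =>
      measurableSet_le (measurable_pi_apply _) (measurable_pi_apply _)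
  · exact MeasurableSet.iInter fun i => MeasurableSet.iInter fun j => MeasurableSet.iInter fun _ =>
      MeasurableSet.iInter fun _ =>
        (measurableSet_eq_fun (measurable_pi_apply (σ i)) (measurable_pi_apply (σ j))).compl

theorem measurableSet_sort {K : ℕ} (p : Equiv.Perm (Fin K) → (Fin K → ℝ) → Prop)
    (hp : ∀ σ, MeasurableSet {v | p σ v}) :
    MeasurableSet {v : Fin K → ℝ | p (Tuple.sort v) v} := by
  have h : {v : Fin K → ℝ | p (Tuple.sort v) v}
      = ⋃ σ : Equiv.Perm (Fin K), {v | Tuple.sort v = σ} ∩ {v | p σ v} := by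
    ext v
    simp
  rw [h]
  exact MeasurableSet.iUnion fun σ => (measurableSet_sort_eq σ).inter (hp σ)

theorem measurableSet_le_gap {K m : ℕ} (hm : 1 ≤ m) (hmK : m < K) (b : ℝ) :
    MeasurableSet {v : Fin K → ℝ | b ≤ gap hm hmK v} :=
  measurableSet_sort (fun σ v => b ≤ v (σ ⟨K - m, by omega⟩) - v (σ ⟨K - m - 1, by omega⟩))
    fun σ => measurableSet_le measurable_const
      (Measurable.sub (f := fun v : Fin K → ℝ => v (σ ⟨K - m, by omega⟩))
        (g := fun v : Fin K → ℝ => v (σ ⟨K - m - 1, by omega⟩))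
        (measurable_pi_apply _) (measurable_pi_apply _))

theorem measurableSet_topSet_eq {K m : ℕ} (hm : 1 ≤ m) (hmK : m < K) (B : Finset (Fin K)) :
    MeasurableSet {v : Fin K → ℝ | topSet hm hmK v = B} :=
  measurableSet_sort
    (fun σ _ => (Finset.Ici (⟨K - m, by omega⟩ : Fin K)).map σ.toEmbedding = B)
    fun _ => MeasurableSet.const _

section GapRule

variable {K m : ℕ} {𝒳 : Fin K → Type*} [∀ k, MeasurableSpace (𝒳 k)]

theorem measurable_LLR (S : Streams K 𝒳) (t : ℕ) :
    Measurable[obsFiltration 𝒳 t] (LLR S t) := by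
  refine @measurable_pi_lambda _ _ _ (obsFiltration 𝒳 t) _ _ fun k => ?_
  refine @Finset.measurable_fun_sum _ _ _ _ _ _ (obsFiltration 𝒳 t) _ _ fun s hs => ?_
  have h1 : Measurable fun x : (k : Fin K) → 𝒳 k =>
      Real.log ((S.f k 1 (x k) : ℝ) / (S.f k 0 (x k) : ℝ)) :=
    ((((S.measurable_f k 1).comp (measurable_pi_apply k)).coe_nnreal_real).div
      (((S.measurable_f k 0).comp (measurable_pi_apply k)).coe_nnreal_real)).log
  have h2 : Measurable[obsFiltration 𝒳 t] (obs (𝒳 := 𝒳) s) :=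
    (comap_measurable (obs (𝒳 := 𝒳) s)).mono
      (le_iSup (fun s : {s : ℕ // s < t} =>
        MeasurableSpace.comap (obs (𝒳 := 𝒳) s) inferInstance) ⟨s, Finset.mem_range.1 hs⟩) le_rfl
  exact h1.comp h2

/-- The stopping time of the Gap rule: the first `t ≥ 1` at which the gap is at least `b`, and `∞`
if there is none. -/
noncomputable def gapTime (S : Streams K 𝒳) (hm : 1 ≤ m) (hmK : m < K) (b : ℝ)
    (ω : Path 𝒳) : ℕ∞ :=
  ⨅ (t : ℕ) (_ : 1 ≤ t ∧ b ≤ gap hm hmK (LLR S t ω)), (t : ℕ∞)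

/-- The decision of the Gap rule: the `m` streams with the largest log-likelihood ratios upon
stopping (the value where the rule never stops is a fixed set of size `m`). -/
noncomputable def gapDecision (S : Streams K 𝒳) (hm : 1 ≤ m) (hmK : m < K) (b : ℝ)
    (ω : Path 𝒳) : Finset (Fin K) :=
  topSet hm hmK (LLR S (gapTime S hm hmK b ω).toNat ω)

theorem gapTime_isStoppingTime (S : Streams K 𝒳) (hm : 1 ≤ m) (hmK : m < K) (b : ℝ) :
    IsStoppingTime (obsFiltration 𝒳) (gapTime S hm hmK b) := by
  intro i
  have h : {ω : Path 𝒳 | gapTime S hm hmK b ω ≤ (i : ℕ∞)}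
      = ⋃ (t : ℕ) (_ : 1 ≤ t ∧ t ≤ i), {ω | b ≤ gap hm hmK (LLR S t ω)} := by
    ext ω
    simp only [Set.mem_ofPred_eq, Set.mem_iUnion, exists_prop]
    rw [← ENat.lt_add_one_iff (ENat.natCast_ne_top i), gapTime]
    simp only [iInf_lt_iff, exists_prop]
    refine exists_congr fun t => ?_
    rw [ENat.lt_add_one_iff (ENat.natCast_ne_top i), Nat.cast_le]
    tauto
  have h' : MeasurableSet[obsFiltration 𝒳 i] {ω : Path 𝒳 | gapTime S hm hmK b ω ≤ (i : ℕ∞)} := by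
    rw [h]
    exact MeasurableSet.iUnion fun t => MeasurableSet.iUnion fun ht =>
      (obsFiltration 𝒳).mono ht.2 _ (measurable_LLR S t (measurableSet_le_gap hm hmK b))
  exact h'

theorem gapDecision_measurable (S : Streams K 𝒳) (hm : 1 ≤ m) (hmK : m < K) (b : ℝ)
    (B : Finset (Fin K)) :
    MeasurableSet[(gapTime_isStoppingTime S hm hmK b).measurableSpace]
      {ω | gapDecision S hm hmK b ω = B} := by
  have hT := gapTime_isStoppingTime S hm hmK b
  have key : ∀ j : ℕ, MeasurableSet[obsFiltration 𝒳 j]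
      ({ω : Path 𝒳 | gapTime S hm hmK b ω = (j : ℕ∞)} ∩ {ω | topSet hm hmK (LLR S j ω) = B}) :=
    fun j => (hT.measurableSet_eq_of_countable j).inter
      (measurable_LLR S j (measurableSet_topSet_eq hm hmK B))
  have htop : MeasurableSet[⨆ t, obsFiltration 𝒳 t]
      {ω : Path 𝒳 | gapTime S hm hmK b ω = ⊤} := by
    have h : {ω : Path 𝒳 | gapTime S hm hmK b ω = ⊤}
        = (⋃ j : ℕ, {ω : Path 𝒳 | gapTime S hm hmK b ω = (j : ℕ∞)})ᶜ := by
      ext ω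
      simp only [Set.mem_ofPred_eq, Set.mem_compl_iff, Set.mem_iUnion]
      rw [← not_iff_not, not_not, ← ne_eq, ENat.ne_top_iff_exists]
      exact exists_congr fun _ => eq_comm
    rw [h]
    exact (MeasurableSet.iUnion fun j =>
      (le_iSup (fun t => (obsFiltration 𝒳 t : MeasurableSpace (Path 𝒳))) j) _
        (hT.measurableSet_eq_of_countable j)).compl
  refine (IsStoppingTime.measurableSet hT _).2 ⟨?_, ?_⟩
  · have h : {ω | gapDecision S hm hmK b ω = B}
        = (⋃ j : ℕ, ({ω : Path 𝒳 | gapTime S hm hmK b ω = (j : ℕ∞)} ∩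
            {ω | topSet hm hmK (LLR S j ω) = B})) ∪
          ({ω : Path 𝒳 | gapTime S hm hmK b ω = ⊤} ∩ {ω | topSet hm hmK (LLR S 0 ω) = B}) := by
      ext ω
      simp only [Set.mem_ofPred_eq, Set.mem_union, Set.mem_iUnion, Set.mem_inter_iff, gapDecision]
      rcases h : gapTime S hm hmK b ω with _ | j
      · change topSet hm hmK (LLR S 0 ω) = B ↔ _
        constructor
        · exact fun h => Or.inr ⟨rfl, h⟩
        · rintro (⟨j, hj, _⟩ | ⟨_, h⟩)
          · exact absurd hj (ENat.natCast_ne_top j).symm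
          · exact h
      · change topSet hm hmK (LLR S j ω) = B ↔ _
        constructor
        · exact fun h => Or.inl ⟨j, rfl, h⟩
        · rintro (⟨i, hi, h⟩ | ⟨h, _⟩)
          · have hij : j = i := by exact_mod_cast (show ((j : ℕ) : ℕ∞) = i from hi)
            rw [hij]
            exact h
          · exact absurd h (ENat.natCast_ne_top j)
    rw [h]
    refine MeasurableSet.union (MeasurableSet.iUnion fun j =>
      (le_iSup (fun t => (obsFiltration 𝒳 t : MeasurableSpace (Path 𝒳))) j) _ (key j)) ?_
    exact htop.inter ((le_iSup (fun t => (obsFiltration 𝒳 t : MeasurableSpace (Path 𝒳))) 0) _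
      (measurable_LLR S 0 (measurableSet_topSet_eq hm hmK B)))
  · intro i
    have h : {ω | gapDecision S hm hmK b ω = B} ∩ {ω | gapTime S hm hmK b ω ≤ (i : ℕ∞)}
        = ⋃ (j : ℕ) (_ : j ≤ i), ({ω : Path 𝒳 | gapTime S hm hmK b ω = (j : ℕ∞)} ∩
            {ω | topSet hm hmK (LLR S j ω) = B}) := by
      ext ω
      simp only [Set.mem_ofPred_eq, Set.mem_iUnion, Set.mem_inter_iff, exists_prop, gapDecision]
      constructor
      · rintro ⟨h1, h2⟩
        obtain ⟨j, hj⟩ := ENat.ne_top_iff_exists.1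
          (ne_top_of_le_ne_top (ENat.natCast_ne_top i) h2)
        rw [← hj, ENat.toNat_natCast] at h1
        rw [← hj, Nat.cast_le] at h2
        exact ⟨j, h2, hj.symm, h1⟩
      · rintro ⟨j, hji, hj, h⟩
        rw [hj, ENat.toNat_natCast, Nat.cast_le]
        exact ⟨h, hji⟩
    have h' : MeasurableSet[obsFiltration 𝒳 i] ({ω | gapDecision S hm hmK b ω = B} ∩
        {ω | gapTime S hm hmK b ω ≤ (i : ℕ∞)}) := by
      rw [h]
      exact MeasurableSet.iUnion fun j => MeasurableSet.iUnion fun hj =>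
        (obsFiltration 𝒳).mono hj _ (key j)
    exact h'

/-- The Gap rule with threshold `b`. -/
noncomputable def gapRule (S : Streams K 𝒳) (hm : 1 ≤ m) (hmK : m < K) (b : ℝ) :
    Procedure 𝒳 (knownNumber K m) where
  T := gapTime S hm hmK b
  D := gapDecision S hm hmK b
  one_le_T := fun _ => le_iInf fun _ => le_iInf fun ht => by exact_mod_cast ht.1
  isStoppingTime_T := gapTime_isStoppingTime S hm hmK b
  measurable_D := gapDecision_measurable S hm hmK b
  D_mem := fun _ => card_topSet hm hmK _

end GapRule

/-- The threshold `|log α| + log (m (K - m))`. -/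
noncomputable def gapThreshold (K m : ℕ) (α : ℝ) : ℝ :=
  |Real.log α| + Real.log ((m : ℝ) * ((K : ℝ) - (m : ℝ)))

end SeqTest

/-! The Gap rule is compared directly with an arbitrary procedure `(T, D)` of the class; no
expansion of the minimal sample size is needed. Fix the true `A`, and for a signal `j` and a
non-signal `i` let `Z` be the difference of their log-likelihood ratios. On `F_t`, `exp (-Z_t)` is
the likelihood ratio of the law `P_B` with `j` and `i` swapped against `P_A`.

Error control (`jointLaw_gapDecision_ne_le`): a wrong decision of the Gap rule forces `Z ≤ -b` for
some pair, an event of `P_A`-probability at most `exp (-b)`; there are `m (K - m)` pairs.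

Optimality: at time `T` the positive part of `b - Z` has bounded mean
(`tsum_setLIntegral_deficit_le`). On `D = A` it is at most `exp (b - Z)`, of mean at most `exp b *
P_B(D = A) ≤ exp b * α = m (K - m)`; on `D ≠ A` it is at most `b + exp (-Z)`, which costs `b α + 1`.
While the Gap rule runs on after `T`, some pair has `Z < b`, and the Euclidean norm of the positive
parts of `b + c - Z` over all pairs loses a fixed amount per step on average, because every `Z` has
positive drift and finite variance (`exists_setLIntegral_posNorm_deficit_succ_le`). So the expected
delay after `T` is bounded by a constant depending neither on `α` nor on the procedure. -/

namespace SeqTest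

/-! ### The likelihood ratio of a single observation. -/

section Observation

variable {K : ℕ} {𝒳 : Fin K → Type*} [∀ k, MeasurableSpace (𝒳 k)]

/-- The log-likelihood ratio of one observation of stream `k`. -/
noncomputable def obsLLR (S : Streams K 𝒳) (k : Fin K) (x : 𝒳 k) : ℝ :=
  Real.log ((S.f k 1 x : ℝ) / (S.f k 0 x : ℝ))

theorem measurable_obsLLR (S : Streams K 𝒳) (k : Fin K) : Measurable (obsLLR S k) :=
  ((S.measurable_f k 1).coe_nnreal_real.div (S.measurable_f k 0).coe_nnreal_real).log

/-- Where only `f k i'` vanishes the extended logarithm is infinite, so the finite second moment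
makes that set null. The two laws are thus mutually absolutely continuous, and changes of measure
are equalities with no singular part. -/
theorem ae_density_ne_zero {S : Streams K 𝒳} (hS : KLPosSecondMoment S) (k : Fin K)
    (i i' : Fin 2) : ∀ᵐ x ∂(S.μ k), S.f k i x ≠ 0 → S.f k i' x ≠ 0 := by
  by_cases h : i = i'
  · subst h; exact Eventually.of_forall fun _ => id
  have hm : Measurable fun x => (ENNReal.log ((S.f k i x : ℝ≥0∞) / (S.f k i' x : ℝ≥0∞))).abs ^ 2
      * (S.f k i x : ℝ≥0∞) := by
    have h1 := (S.measurable_f k i).coe_nnreal_ennreal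
    have h2 := (S.measurable_f k i').coe_nnreal_ennreal
    have hab : Measurable EReal.abs :=
      EReal.measurable_of_measurable_real (measurable_id.abs.ennreal_ofReal)
    have h3 : Measurable fun x => (ENNReal.log ((S.f k i x : ℝ≥0∞) / (S.f k i' x : ℝ≥0∞))).abs :=
      hab.comp (ENNReal.measurable_log.comp (h1.div h2))
    exact (h3.pow_const 2).mul h1
  filter_upwards [ae_lt_top hm (hS k i i' h).2.ne] with x hx hi hi'
  have hi2 : (S.f k i x : ℝ≥0∞) ≠ 0 := by simpa using hi
  rw [hi', ENNReal.coe_zero, ENNReal.div_zero hi2, ENNReal.log_top, EReal.abs_top] at hx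
  simp [ENNReal.top_mul hi2] at hx

/-- The factor `i' - i`, one of `-1`, `0`, `1`, lets the single statistic `log (f₁ / f₀)` express
all four density ratios. -/
theorem exp_mul_obsLLR (S : Streams K 𝒳) (k : Fin K) (i i' : Fin 2) (x : 𝒳 k)
    (h0 : S.f k 0 x ≠ 0) (h1 : S.f k 1 x ≠ 0) :
    Real.exp ((((i' : ℕ) : ℝ) - ((i : ℕ) : ℝ)) * obsLLR S k x)
      = (S.f k i' x : ℝ) / (S.f k i x : ℝ) := by
  have h0' : (0 : ℝ) < S.f k 0 x := by positivity
  have h1' : (0 : ℝ) < S.f k 1 x := by positivity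
  fin_cases i <;> fin_cases i' <;>
    simp [obsLLR, Real.exp_neg, Real.exp_log (div_pos h1' h0'), h0'.ne', h1'.ne']

theorem setLIntegral_exp_obsLLR {S : Streams K 𝒳} (hS : KLPosSecondMoment S) (k : Fin K)
    (i i' : Fin 2) {s : Set (𝒳 k)} (hs : MeasurableSet s) :
    ∫⁻ x in s, ENNReal.ofReal (Real.exp ((((i' : ℕ) : ℝ) - ((i : ℕ) : ℝ)) * obsLLR S k x))
      ∂(obsLaw S k i) = obsLaw S k i' s := by
  have hm : Measurable fun x =>
      ENNReal.ofReal (Real.exp ((((i' : ℕ) : ℝ) - ((i : ℕ) : ℝ)) * obsLLR S k x)) :=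
    ((measurable_obsLLR S k).const_mul _).exp.ennreal_ofReal
  rw [obsLaw, obsLaw, setLIntegral_withDensity_eq_setLIntegral_mul _
    (S.measurable_f k i).coe_nnreal_ennreal hm hs, withDensity_apply _ hs]
  refine setLIntegral_congr_fun_ae hs ?_
  filter_upwards [ae_density_ne_zero hS k 0 1, ae_density_ne_zero hS k 1 0] with x h01 h10 _
  rw [Pi.mul_apply]
  by_cases h0 : S.f k 0 x = 0
  · have h1 : S.f k 1 x = 0 := by_contra fun h => h10 h h0
    have h : ∀ i, S.f k i x = 0 := fun i => by fin_cases i <;> assumption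
    simp [h]
  · have h1 := h01 h0
    have h : ∀ i, S.f k i x ≠ 0 := fun i => by fin_cases i <;> assumption
    rw [exp_mul_obsLLR S k i i' x h0 h1, ← NNReal.coe_div, ENNReal.ofReal_coe_nnreal,
      ← ENNReal.coe_mul, mul_div_cancel₀ _ (h i)]

theorem memLp_obsLLR {S : Streams K 𝒳} (hS : KLPosSecondMoment S) (k : Fin K) (i : Fin 2) :
    MemLp (obsLLR S k) 2 (obsLaw S k i) := by
  refine ⟨(measurable_obsLLR S k).aestronglyMeasurable, ?_⟩
  rw [eLpNorm_lt_top_iff_lintegral_rpow_enorm_lt_top (by norm_num) (by norm_num), obsLaw,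
    lintegral_withDensity_eq_lintegral_mul _ (S.measurable_f k i).coe_nnreal_ennreal
      ((measurable_obsLLR S k).enorm.pow_const _)]
  -- In `Fin 2`, `1 - i` is the other hypothesis. The absolute value makes the orientation of the
  -- ratio irrelevant.
  have hii : i ≠ 1 - i := by fin_cases i <;> simp
  refine lt_of_le_of_lt (lintegral_mono_ae ?_) (hS k i (1 - i) hii).2
  filter_upwards [ae_density_ne_zero hS k i (1 - i)] with x hx
  rw [Pi.mul_apply, mul_comm]
  by_cases h : S.f k i x = 0
  · simp [h]
  have h' := hx h
  refine mul_le_mul_left (le_of_eq ?_) _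
  have hp : ∀ j, (0 : ℝ) < S.f k j x := by
    intro j
    have : S.f k j x ≠ 0 := by
      fin_cases i <;> fin_cases j <;> simp_all
    positivity
  rw [← ENNReal.coe_div h', ← ENNReal.ofReal_coe_nnreal, ENNReal.log_ofReal_of_pos
    (by push_cast; exact div_pos (hp _) (hp _)), EReal.abs_def]
  have : |Real.log ((S.f k i x / S.f k (1 - i) x : ℝ≥0) : ℝ)| = ‖obsLLR S k x‖ := by
    rw [obsLLR, Real.norm_eq_abs, NNReal.coe_div, Real.log_div (hp _).ne' (hp _).ne',
      Real.log_div (hp _).ne' (hp _).ne']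
    fin_cases i
    · simpa using abs_sub_comm _ _
    · simp
  rw [this, ofReal_norm]
  norm_num

theorem integral_obsLaw (S : Streams K 𝒳) (k : Fin K) (i : Fin 2) (g : 𝒳 k → ℝ) :
    ∫ x, g x ∂(obsLaw S k i) = ∫ x, g x * (S.f k i x : ℝ) ∂(S.μ k) := by
  rw [obsLaw, integral_withDensity_eq_integral_smul (S.measurable_f k i)]
  exact integral_congr_ae (Eventually.of_forall fun x => by simp [NNReal.smul_def, mul_comm])

theorem integral_obsLLR_one_pos {S : Streams K 𝒳} (hS : KLPosSecondMoment S) (k : Fin K) :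
    0 < ∫ x, obsLLR S k x ∂(obsLaw S k 1) := by
  rw [integral_obsLaw]
  exact (hS k 1 0 (by simp)).1

theorem integral_obsLLR_zero_neg {S : Streams K 𝒳} (hS : KLPosSecondMoment S) (k : Fin K) :
    ∫ x, obsLLR S k x ∂(obsLaw S k 0) < 0 := by
  rw [integral_obsLaw]
  have h := (hS k 0 1 (by simp)).1
  have : ∀ x, obsLLR S k x * (S.f k 0 x : ℝ)
      = -(Real.log ((S.f k 0 x : ℝ) / (S.f k 1 x : ℝ)) * (S.f k 0 x : ℝ)) := fun x => by
    rw [obsLLR, ← inv_div, Real.log_inv]; ring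
  simp_rw [this]
  rw [integral_neg]
  linarith

end Observation

/-! ### The joint law, independence of past and future, and change of measure. -/

section Law

variable {K : ℕ} {𝒳 : Fin K → Type*} [∀ k, MeasurableSpace (𝒳 k)]

/-- The hypothesis that is true for stream `k` when the signal subset is `A`. -/
def hyp (A : Finset (Fin K)) (k : Fin K) : Fin 2 := if k ∈ A then 1 else 0

instance instStreamLawProb (S : Streams K 𝒳) (k : Fin K) (i : Fin 2) :
    IsProbabilityMeasure (streamLaw S k i) := by
  unfold streamLaw; infer_instance

instance instJointLawProb (S : Streams K 𝒳) (A : Finset (Fin K)) :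
    IsProbabilityMeasure (jointLaw S A) := by
  unfold jointLaw; infer_instance

theorem measurable_coord (k : Fin K) (s : ℕ) : Measurable fun ω : Path 𝒳 => ω k s :=
  (measurable_pi_apply s).comp (measurable_pi_apply k)

theorem jointLaw_eq_infinitePi (S : Streams K 𝒳) (A : Finset (Fin K)) :
    jointLaw S A
      = Measure.infinitePi fun k => Measure.infinitePi fun _ : ℕ => obsLaw S k (hyp A k) := by
  rw [Measure.infinitePi_eq_pi]
  rfl

theorem measurePreserving_coord (S : Streams K 𝒳) (A : Finset (Fin K)) (k : Fin K) (s : ℕ) :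
    MeasurePreserving (fun ω : Path 𝒳 => ω k s) (jointLaw S A) (obsLaw S k (hyp A k)) := by
  rw [jointLaw_eq_infinitePi]
  exact (measurePreserving_eval_infinitePi (fun _ : ℕ => obsLaw S k (hyp A k)) s).comp
    (measurePreserving_eval_infinitePi
      (fun k => Measure.infinitePi fun _ : ℕ => obsLaw S k (hyp A k)) k)

theorem iIndepFun_coord (S : Streams K 𝒳) (A : Finset (Fin K)) :
    ProbabilityTheory.iIndepFun (fun (p : Fin K × ℕ) (ω : Path 𝒳) => ω p.1 p.2)
      (jointLaw S A) := by
  rw [jointLaw_eq_infinitePi]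
  exact ProbabilityTheory.iIndepFun_uncurry_infinitePi' (X := fun _ _ x => x)
    (fun k (_ : ℕ) => obsLaw S k (hyp A k)) (fun _ _ => measurable_id)

theorem comap_obs_le_iSup (t : ℕ) :
    MeasurableSpace.comap (obs (𝒳 := 𝒳) t) inferInstance ≤
      ⨆ p ∈ {p : Fin K × ℕ | p.2 = t},
        MeasurableSpace.comap (fun ω : Path 𝒳 => ω p.1 p.2) inferInstance := by
  rw [MeasurableSpace.pi, MeasurableSpace.comap_iSup]
  refine iSup_le fun k => ?_
  rw [MeasurableSpace.comap_comp]
  exact le_iSup₂_of_le (k, t) rfl le_rfl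

theorem obsFiltration_le_iSup (t : ℕ) :
    (obsFiltration 𝒳 t : MeasurableSpace (Path 𝒳)) ≤
      ⨆ p ∈ {p : Fin K × ℕ | p.2 < t},
        MeasurableSpace.comap (fun ω : Path 𝒳 => ω p.1 p.2) inferInstance := by
  refine iSup_le fun s => (comap_obs_le_iSup (s : ℕ)).trans ?_
  exact biSup_mono fun p (hp : p.2 = s) => show p.2 < t from hp.trans_lt s.2

/-- Times are counted from `0`: `F_t` sees the indices below `t`, so `obs t` is the first
observation outside it, and the two index sets are disjoint. -/
theorem indep_obsFiltration_obs (S : Streams K 𝒳) (A : Finset (Fin K)) (t : ℕ) :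
    ProbabilityTheory.Indep (obsFiltration 𝒳 t)
      (MeasurableSpace.comap (obs (𝒳 := 𝒳) t) inferInstance) (jointLaw S A) := by
  have h := ProbabilityTheory.indep_iSup_of_disjoint
    (fun p : Fin K × ℕ => (measurable_coord (𝒳 := 𝒳) p.1 p.2).comap_le)
    (iIndepFun_coord S A).iIndep (S := {p : Fin K × ℕ | p.2 < t})
    (T := {p : Fin K × ℕ | p.2 = t})
    (Set.disjoint_left.2 fun p (h1 : p.2 < t) (h2 : p.2 = t) => absurd h2 h1.ne)
  exact ProbabilityTheory.indep_of_indep_of_le_left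
    (ProbabilityTheory.indep_of_indep_of_le_right h (comap_obs_le_iSup t))
    (obsFiltration_le_iSup t)

/-- The observations of all the streams up to time `t`. -/
def history (t : ℕ) (ω : Path 𝒳) : (p : Fin K × Fin t) → 𝒳 p.1 := fun p => ω p.1 p.2

theorem measurable_history (t : ℕ) : Measurable (history (𝒳 := 𝒳) t) :=
  measurable_pi_lambda _ fun p => measurable_coord p.1 p.2

/-- Events of `F_t` depend on finitely many coordinates only, so a change of measure on `F_t` can be
checked on a finite product. -/
theorem obsFiltration_le_comap_history (t : ℕ) :
    (obsFiltration 𝒳 t : MeasurableSpace (Path 𝒳)) ≤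
      MeasurableSpace.comap (history t) inferInstance := by
  refine (obsFiltration_le_iSup t).trans (iSup₂_le fun p hp => ?_)
  have : (fun ω : Path 𝒳 => ω p.1 p.2)
      = (fun x : (p : Fin K × Fin t) → 𝒳 p.1 => x (p.1, ⟨p.2, hp⟩)) ∘ history t := rfl
  have hm : Measurable fun x : (p : Fin K × Fin t) → 𝒳 p.1 => x (p.1, ⟨p.2, hp⟩) :=
    measurable_pi_apply _
  rw [this, ← MeasurableSpace.comap_comp]
  exact MeasurableSpace.comap_mono hm.comap_le

theorem iIndepFun_history (S : Streams K 𝒳) (A : Finset (Fin K)) (t : ℕ) :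
    ProbabilityTheory.iIndepFun (fun (p : Fin K × Fin t) (ω : Path 𝒳) => ω p.1 p.2)
      (jointLaw S A) :=
  ProbabilityTheory.iIndepFun.precomp (g := fun p : Fin K × Fin t => (p.1, (p.2 : ℕ)))
    (fun p q h => by
      simp only [Prod.mk.injEq] at h
      exact Prod.ext h.1 (Fin.ext h.2)) (iIndepFun_coord S A)

theorem jointLaw_map_history (S : Streams K 𝒳) (A : Finset (Fin K)) (t : ℕ) :
    (jointLaw S A).map (history t)
      = Measure.pi fun p : Fin K × Fin t => obsLaw S p.1 (hyp A p.1) := by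
  have h := (ProbabilityTheory.iIndepFun_iff_map_fun_eq_pi_map
    (fun p : Fin K × Fin t => (measurable_coord (𝒳 := 𝒳) p.1 p.2).aemeasurable)).1
    (iIndepFun_history S A t)
  refine h.trans ?_
  congr 1
  funext p
  exact (measurePreserving_coord S A p.1 p.2).map_eq

/-- The log-likelihood ratio of the first `t` observations for the signal subset `B` against the
signal subset `A`. -/
noncomputable def jointLLR (S : Streams K 𝒳) (A B : Finset (Fin K)) (t : ℕ) (ω : Path 𝒳) : ℝ :=
  ∑ k, (((hyp B k : ℕ) : ℝ) - ((hyp A k : ℕ) : ℝ)) * LLR S t ω k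

theorem LLR_eq_sum (S : Streams K 𝒳) (t : ℕ) (ω : Path 𝒳) (k : Fin K) :
    LLR S t ω k = ∑ s ∈ Finset.range t, obsLLR S k (ω k s) := rfl

theorem measurable_jointLLR (S : Streams K 𝒳) (A B : Finset (Fin K)) (t : ℕ) :
    Measurable (jointLLR S A B t) := by
  have h : Measurable (LLR S t) := (measurable_LLR S t).mono ((obsFiltration 𝒳).le t) le_rfl
  exact Finset.measurable_fun_sum _ fun k _ => ((measurable_pi_apply k).comp h).const_mul _

theorem ofReal_exp_jointLLR (S : Streams K 𝒳) (A B : Finset (Fin K)) (t : ℕ) (ω : Path 𝒳) :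
    ENNReal.ofReal (Real.exp (jointLLR S A B t ω))
      = ∏ p : Fin K × Fin t, ENNReal.ofReal (Real.exp
        ((((hyp B p.1 : ℕ) : ℝ) - ((hyp A p.1 : ℕ) : ℝ)) * obsLLR S p.1 (ω p.1 p.2))) := by
  rw [← ENNReal.ofReal_prod_of_nonneg fun _ _ => (Real.exp_pos _).le, ← Real.exp_sum,
    Fintype.sum_prod_type, jointLLR]
  congr 2
  refine Finset.sum_congr rfl fun k _ => ?_
  rw [LLR_eq_sum, Finset.mul_sum, Finset.sum_range]

/-- Change of measure on `F_t`. -/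
theorem setLIntegral_exp_jointLLR {S : Streams K 𝒳} (hS : KLPosSecondMoment S)
    (A B : Finset (Fin K)) (t : ℕ) {E : Set (Path 𝒳)} (hE : MeasurableSet[obsFiltration 𝒳 t] E) :
    ∫⁻ ω in E, ENNReal.ofReal (Real.exp (jointLLR S A B t ω)) ∂(jointLaw S A)
      = jointLaw S B E := by
  set L : Path 𝒳 → ℝ≥0∞ := fun ω => ENNReal.ofReal (Real.exp (jointLLR S A B t ω))
  have hL : Measurable L := (measurable_jointLLR S A B t).exp.ennreal_ofReal
  -- A finite product measure is determined by boxes. On a box the density splits into factors of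
  -- the single coordinates, and independence reduces the claim to one observation.
  have key : ((jointLaw S A).withDensity L).map (history t) = (jointLaw S B).map (history t) := by
    rw [jointLaw_map_history]
    refine (Measure.pi_eq fun s hs => ?_).symm
    have hms : MeasurableSet (Set.univ.pi s) := MeasurableSet.univ_pi hs
    have hpre := measurable_history t hms
    rw [Measure.map_apply (measurable_history t) hms, withDensity_apply _ hpre,
      ← lintegral_indicator hpre]
    let w : (p : Fin K × Fin t) → 𝒳 p.1 → ℝ≥0∞ := fun p => (s p).indicator fun x =>
      ENNReal.ofReal (Real.exp
        ((((hyp B p.1 : ℕ) : ℝ) - ((hyp A p.1 : ℕ) : ℝ)) * obsLLR S p.1 x))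
    have hw : ∀ p, Measurable (w p) := fun p =>
      (((measurable_obsLLR S p.1).const_mul _).exp.ennreal_ofReal).indicator (hs p)
    have hprod : ∀ ω : Path 𝒳,
        (history t ⁻¹' Set.univ.pi s).indicator L ω = ∏ p, w p (ω p.1 p.2) := by
      intro ω
      by_cases hω : ω ∈ history t ⁻¹' Set.univ.pi s
      · rw [Set.indicator_of_mem hω]
        refine (ofReal_exp_jointLLR S A B t ω).trans (Finset.prod_congr rfl fun p _ => ?_)
        have hp : ω p.1 p.2 ∈ s p := hω p (Set.mem_univ p)
        simp only [w, Set.indicator_of_mem hp]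
      · rw [Set.indicator_of_notMem hω]
        have : ∃ p, ω p.1 p.2 ∉ s p := by
          simpa [Set.mem_pi, history] using hω
        obtain ⟨p, hp⟩ := this
        have hz : w p (ω p.1 p.2) = 0 := Set.indicator_of_notMem hp _
        exact (Finset.prod_eq_zero (Finset.mem_univ p) hz).symm
    simp_rw [hprod]
    rw [ProbabilityTheory.lintegral_prod_eq_prod_lintegral_of_indepFun Finset.univ
      (fun (p : Fin K × Fin t) (ω : Path 𝒳) => w p (ω p.1 p.2))
      ((iIndepFun_history S A t).comp _ hw)
      (fun p => (hw p).comp (measurable_coord p.1 p.2))]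
    refine Finset.prod_congr rfl fun p _ => ?_
    rw [(measurePreserving_coord S A p.1 p.2).lintegral_comp (hw p),
      lintegral_indicator (hs p), setLIntegral_exp_obsLLR hS p.1 _ _ (hs p)]
  obtain ⟨F, hF, rfl⟩ := obsFiltration_le_comap_history t E hE
  rw [← withDensity_apply _ (measurable_history t hF), ← Measure.map_apply (measurable_history t) hF,
    key, Measure.map_apply (measurable_history t) hF]

/-- Only the two exchanged streams change their hypothesis, so all other terms cancel. -/
theorem jointLLR_insert_erase (S : Streams K 𝒳) {A : Finset (Fin K)} {i j : Fin K} (hi : i ∉ A)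
    (hj : j ∈ A) (t : ℕ) (ω : Path 𝒳) :
    jointLLR S A (insert i (A.erase j)) t ω = LLR S t ω i - LLR S t ω j := by
  have hij : i ≠ j := fun h => hi (h ▸ hj)
  have h : ∀ k, (((hyp (insert i (A.erase j)) k : ℕ) : ℝ) - ((hyp A k : ℕ) : ℝ)) * LLR S t ω k
      = (if k = i then LLR S t ω k else 0) - (if k = j then LLR S t ω k else 0) := by
    intro k
    unfold hyp
    by_cases h1 : k = i
    · subst h1; simp [hi, hij]
    · by_cases h2 : k = j
      · subst h2; simp [hj, h1]
      · by_cases h3 : k ∈ A <;> simp [h1, h2, h3]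
  simp_rw [jointLLR, h]
  rw [Finset.sum_sub_distrib]
  simp

end Law

/-! ### The Euclidean norm of positive parts as a Lyapunov function. -/

section Lyapunov

variable {ι : Type*}

/-- The Euclidean norm of the positive part of the coordinates of `y` in `s`. -/
noncomputable def posNorm (s : Finset ι) (y : ι → ℝ) : ℝ := √(∑ p ∈ s, max (y p) 0 ^ 2)

theorem posNorm_nonneg (s : Finset ι) (y : ι → ℝ) : 0 ≤ posNorm s y := Real.sqrt_nonneg _

theorem posNorm_sq (s : Finset ι) (y : ι → ℝ) :
    posNorm s y ^ 2 = ∑ p ∈ s, max (y p) 0 ^ 2 :=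
  Real.sq_sqrt (Finset.sum_nonneg fun _ _ => sq_nonneg _)

theorem posNorm_le_sum (s : Finset ι) (y : ι → ℝ) : posNorm s y ≤ ∑ p ∈ s, max (y p) 0 :=
  Real.sqrt_le_iff.2 ⟨Finset.sum_nonneg fun _ _ => le_max_right _ _,
    Finset.sum_sq_le_sq_sum_of_nonneg fun _ _ => le_max_right _ _⟩

theorem max_le_posNorm {s : Finset ι} (y : ι → ℝ) {p : ι} (hp : p ∈ s) :
    max (y p) 0 ≤ posNorm s y :=
  Real.le_sqrt_of_sq_le
    (Finset.single_le_sum (f := fun p => max (y p) 0 ^ 2) (fun _ _ => sq_nonneg _) hp)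

/-- Second-order Taylor bound: the squared positive part has derivative `2 * max y 0`, which is
Lipschitz with constant `2`. -/
theorem max_sub_sq_le (y ξ : ℝ) :
    max (y - ξ) 0 ^ 2 ≤ max y 0 ^ 2 - 2 * (max y 0 * ξ) + ξ ^ 2 := by
  rcases le_total y 0 with h | h <;> rcases le_total (y - ξ) 0 with h' | h' <;>
    simp only [max_eq_left, max_eq_right, h, h'] <;> nlinarith [sq_nonneg (y - ξ), sq_nonneg ξ]

theorem posNorm_sub_le (s : Finset ι) (y ξ : ι → ℝ) {c : ℝ} (hc : 0 < c)
    (hy : c ≤ posNorm s y) :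
    posNorm s (fun p => y p - ξ p) ≤ posNorm s y - ∑ p ∈ s, max (y p) 0 / posNorm s y * ξ p
      + ∑ p ∈ s, ξ p ^ 2 / (2 * c) := by
  set U := posNorm s y
  set U' := posNorm s fun p => y p - ξ p
  have hU : 0 < U := hc.trans_le hy
  have hV : U' ^ 2 ≤ U ^ 2 - 2 * ∑ p ∈ s, max (y p) 0 * ξ p + ∑ p ∈ s, ξ p ^ 2 := by
    rw [posNorm_sq, posNorm_sq, Finset.mul_sum, ← Finset.sum_sub_distrib, ← Finset.sum_add_distrib]
    exact Finset.sum_le_sum fun p _ => max_sub_sq_le _ _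
  have h1 : ∑ p ∈ s, max (y p) 0 / U * ξ p = (∑ p ∈ s, max (y p) 0 * ξ p) / U := by
    rw [Finset.sum_div]; exact Finset.sum_congr rfl fun p _ => by ring
  have h2 : (∑ p ∈ s, ξ p ^ 2) / (2 * U) ≤ ∑ p ∈ s, ξ p ^ 2 / (2 * c) := by
    rw [← Finset.sum_div]
    have : 0 ≤ ∑ p ∈ s, ξ p ^ 2 := Finset.sum_nonneg fun _ _ => sq_nonneg _
    gcongr
  rw [h1]
  refine le_trans ?_ (add_le_add_right h2 _)
  rw [← sub_nonneg]
  -- The square root lies below its tangent at `U ^ 2`; the term `(U - U') ^ 2` is the exact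
  -- remainder.
  have h3 : U - (∑ p ∈ s, max (y p) 0 * ξ p) / U + (∑ p ∈ s, ξ p ^ 2) / (2 * U) - U'
      = (U ^ 2 - 2 * ∑ p ∈ s, max (y p) 0 * ξ p + ∑ p ∈ s, ξ p ^ 2 - U' ^ 2 + (U - U') ^ 2)
        / (2 * U) := by
    field_simp; ring
  rw [h3]
  have := sq_nonneg (U - U')
  exact div_nonneg (by linarith) (by linarith)

variable {Ω : Type*}

theorem measurable_posNorm {_ : MeasurableSpace Ω} (s : Finset ι) {y : ι → Ω → ℝ}
    (hy : ∀ p, Measurable (y p)) : Measurable fun ω => posNorm s fun p => y p ω :=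
  (Finset.measurable_fun_sum _ fun p _ =>
    ((hy p).max measurable_const).pow_const 2).sqrt

theorem integrable_posNorm {_ : MeasurableSpace Ω} {P : Measure Ω} (s : Finset ι) {y : ι → Ω → ℝ}
    (hy : ∀ p, Measurable (y p)) (hi : ∀ p, Integrable (y p) P) :
    Integrable (fun ω => posNorm s fun p => y p ω) P := by
  refine Integrable.mono' (integrable_finsetSum s fun p _ => (hi p).pos_part)
    (measurable_posNorm s hy).aestronglyMeasurable (Eventually.of_forall fun ω => ?_)
  rw [Real.norm_of_nonneg (posNorm_nonneg _ _)]
  exact posNorm_le_sum s _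

/-- One step of a random walk with increments of mean at least `r` decreases the expected Euclidean
norm of the positive part of the distance to the target, as long as the norm is at least `c`. -/
theorem setIntegral_posNorm_sub_le {m m' mΩ : MeasurableSpace Ω} {P : Measure Ω}
    [IsProbabilityMeasure P] (hm : m ≤ mΩ) (hm' : m' ≤ mΩ)
    (hind : ProbabilityTheory.Indep m m' P) (s : Finset ι) {y ξ : ι → Ω → ℝ}
    (hy : ∀ p, Measurable[m] (y p)) (hyi : ∀ p, Integrable (y p) P)
    (hξ : ∀ p, Measurable[m'] (ξ p)) (hξ2 : ∀ p, MemLp (ξ p) 2 P) {r c : ℝ} (hr : 0 ≤ r)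
    (hmean : ∀ p ∈ s, r ≤ ∫ ω, ξ p ω ∂P) (hc : 0 < c) {E : Set Ω} (hE : MeasurableSet[m] E)
    (hEc : ∀ ω ∈ E, c ≤ posNorm s fun p => y p ω) :
    ∫ ω in E, posNorm s (fun p => y p ω - ξ p ω) ∂P ≤
      ∫ ω in E, posNorm s (fun p => y p ω) ∂P
        - (r - (∑ p ∈ s, ∫ ω, ξ p ω ^ 2 ∂P) / (2 * c)) * P.real E := by
  have hξi : ∀ p, Integrable (ξ p) P := fun p => (hξ2 p).integrable (by norm_num)
  have hξ2i : ∀ p, Integrable (fun ω => ξ p ω ^ 2) P := fun p => (hξ2 p).integrable_sq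
  -- The gradient of the norm, cut off to `E`. It is known before the increment and lies in `[0,
  -- 1]`, so its products with the increments factor in expectation.
  let g : ι → Ω → ℝ := fun p => E.indicator fun ω => max (y p ω) 0 / posNorm s fun p => y p ω
  have hg : ∀ p, Measurable[m] (g p) := fun p =>
    Measurable.indicator (((hy p).max measurable_const).div (measurable_posNorm s hy)) hE
  have hg0 : ∀ p ω, 0 ≤ g p ω := fun p ω => Set.indicator_nonneg
    (fun ω _ => div_nonneg (le_max_right _ _) (posNorm_nonneg _ _)) ω
  have hg1 : ∀ p ∈ s, ∀ ω, ‖g p ω‖ ≤ 1 := fun p hp ω => by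
    rw [Real.norm_of_nonneg (hg0 p ω)]
    refine Set.indicator_apply_le' (fun _ => ?_) fun _ => zero_le_one
    exact div_le_one_of_le₀ (max_le_posNorm (fun p => y p ω) hp) (posNorm_nonneg _ _)
  have hgm : ∀ p, Measurable (g p) := fun p => (hg p).mono hm le_rfl
  have hgi : ∀ p ∈ s, Integrable (g p) P := fun p hp =>
    Integrable.of_bound (hgm p).aestronglyMeasurable 1 (Eventually.of_forall (hg1 p hp))
  have hgξi : ∀ p ∈ s, Integrable (fun ω => g p ω * ξ p ω) P := fun p hp =>
    (hξi p).bdd_mul (hgm p).aestronglyMeasurable (Eventually.of_forall (hg1 p hp))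
  have hgξ : ∀ p ∈ s, r * ∫ ω, g p ω ∂P ≤ ∫ ω, g p ω * ξ p ω ∂P := fun p hp => by
    have hif : ProbabilityTheory.IndepFun (g p) (ξ p) P :=
      ProbabilityTheory.indep_of_indep_of_le_left
        (ProbabilityTheory.indep_of_indep_of_le_right hind (hξ p).comap_le) (hg p).comap_le
    rw [hif.integral_fun_mul_eq_mul_integral (hgm p).aestronglyMeasurable
      ((hξ p).mono hm' le_rfl).aestronglyMeasurable, mul_comm]
    exact mul_le_mul_of_nonneg_left (hmean p hp) (integral_nonneg (hg0 p))
  have hEm := hm E hE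
  have hsq : ∀ p, ∫ ω in E, ξ p ω ^ 2 ∂P = P.real E * ∫ ω, ξ p ω ^ 2 ∂P := fun p => by
    have hif : ProbabilityTheory.IndepFun (E.indicator fun _ => (1 : ℝ)) (fun ω => ξ p ω ^ 2) P :=
      ProbabilityTheory.indep_of_indep_of_le_left
        (ProbabilityTheory.indep_of_indep_of_le_right hind ((hξ p).pow_const 2).comap_le)
        (Measurable.indicator measurable_const hE).comap_le
    have h := hif.integral_fun_mul_eq_mul_integral
      (measurable_const.indicator hEm).aestronglyMeasurable (hξ2i p).aestronglyMeasurable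
    rw [integral_indicator hEm, setIntegral_const, smul_eq_mul, mul_one] at h
    rw [← h, ← integral_indicator hEm]
    refine integral_congr_ae (Eventually.of_forall fun ω => ?_)
    by_cases hω : ω ∈ E <;> simp [hω]
  -- On `E` the weights sum to at least `1`, because the `ℓ¹` norm dominates the `ℓ²` norm. Hence
  -- the full drift `r` is retained.
  have hgsum : P.real E ≤ ∑ p ∈ s, ∫ ω, g p ω ∂P := by
    rw [← integral_finsetSum s hgi, ← integral_indicator_one hEm]
    refine integral_mono ((integrable_const 1).indicator hEm) (integrable_finsetSum s hgi)
      fun ω => ?_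
    by_cases hω : ω ∈ E
    · simp only [g, Set.indicator_of_mem hω, Pi.one_apply]
      rw [← Finset.sum_div, one_le_div (hc.trans_le (hEc ω hω))]
      exact posNorm_le_sum s _
    · simp [g, hω]
  have hUi := integrable_posNorm s (fun p => (hy p).mono hm le_rfl) hyi
  have hU'i : Integrable (fun ω => posNorm s fun p => y p ω - ξ p ω) P :=
    integrable_posNorm s (fun p => ((hy p).mono hm le_rfl).sub ((hξ p).mono hm' le_rfl))
      fun p => (hyi p).sub (hξi p)
  have hGi : Integrable (fun ω => ∑ p ∈ s, g p ω * ξ p ω) P := integrable_finsetSum s hgξi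
  have hSi : Integrable (fun ω => ∑ p ∈ s, ξ p ω ^ 2 / (2 * c)) P :=
    integrable_finsetSum s fun p _ => (hξ2i p).div_const _
  have hUGi : Integrable (fun ω => posNorm s (fun p => y p ω) - ∑ p ∈ s, g p ω * ξ p ω) P :=
    hUi.sub hGi
  have hmono : ∫ ω in E, posNorm s (fun p => y p ω - ξ p ω) ∂P ≤
      ∫ ω in E, (posNorm s (fun p => y p ω) - ∑ p ∈ s, g p ω * ξ p ω
        + ∑ p ∈ s, ξ p ω ^ 2 / (2 * c)) ∂P := by
    refine setIntegral_mono_on hU'i.integrableOn (hUGi.add hSi).integrableOn hEm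
      fun ω hω => ?_
    have := posNorm_sub_le s (fun p => y p ω) (fun p => ξ p ω) hc (hEc ω hω)
    simpa only [g, Set.indicator_of_mem hω] using this
  have hGE : ∫ ω in E, ∑ p ∈ s, g p ω * ξ p ω ∂P = ∑ p ∈ s, ∫ ω, g p ω * ξ p ω ∂P := by
    rw [← integral_finsetSum s hgξi]
    refine setIntegral_eq_integral_of_forall_compl_eq_zero fun ω hω => ?_
    exact Finset.sum_eq_zero fun p _ => by simp [g, hω]
  have hSE : ∫ ω in E, ∑ p ∈ s, ξ p ω ^ 2 / (2 * c) ∂P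
      = (∑ p ∈ s, ∫ ω, ξ p ω ^ 2 ∂P) / (2 * c) * P.real E := by
    rw [integral_finsetSum s fun p _ => ((hξ2i p).div_const _).integrableOn, Finset.sum_div,
      Finset.sum_mul]
    refine Finset.sum_congr rfl fun p _ => ?_
    rw [integral_div, hsq]; ring
  rw [integral_add hUGi.integrableOn hSi.integrableOn,
    integral_sub hUi.integrableOn hGi.integrableOn, hGE, hSE] at hmono
  have h1 : r * P.real E ≤ ∑ p ∈ s, ∫ ω, g p ω * ξ p ω ∂P := by
    refine (mul_le_mul_of_nonneg_left hgsum hr).trans ?_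
    rw [Finset.mul_sum]
    exact Finset.sum_le_sum hgξ
  linarith

end Lyapunov

/-! ### Drift bounds between two stopping times. -/

section StoppingTime

theorem tsum_ite_lt_eq_toENNReal (b : ℕ∞) :
    ∑' t : ℕ, (if (t : ℕ∞) < b then (1 : ℝ≥0∞) else 0) = b := by
  induction b using ENat.recTopCoe with
  | top =>
    simp only [ENat.natCast_lt_top, if_true, ENat.toENNReal_top]
    exact ENNReal.tsum_const_eq_top_of_ne_zero one_ne_zero
  | coe n =>
    simp only [Nat.cast_lt]
    rw [tsum_eq_sum (s := Finset.range n) fun t ht => if_neg (by simpa using ht)]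
    rw [Finset.sum_congr rfl fun t ht => if_pos (Finset.mem_range.1 ht)]
    simp

theorem toENNReal_le_add_tsum (a b : ℕ∞) :
    (b : ℝ≥0∞) ≤ a + ∑' t : ℕ, (if a ≤ (t : ℕ∞) ∧ (t : ℕ∞) < b then (1 : ℝ≥0∞) else 0) := by
  rw [← tsum_ite_lt_eq_toENNReal b, ← tsum_ite_lt_eq_toENNReal a, ← ENNReal.tsum_add]
  refine ENNReal.tsum_le_tsum fun t => ?_
  by_cases h1 : (t : ℕ∞) < b <;> by_cases h2 : (t : ℕ∞) < a <;> simp [h1, h2, not_lt.1]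

variable {Ω : Type*} {mΩ : MeasurableSpace Ω} {P : Measure Ω} {ℱ : Filtration ℕ mΩ}

theorem measurableSet_le_inter_lt {T τ : Ω → ℕ∞} (hT : IsStoppingTime ℱ T)
    (hτ : IsStoppingTime ℱ τ) (t : ℕ) :
    MeasurableSet[ℱ t] {ω | T ω ≤ (t : ℕ∞) ∧ (t : ℕ∞) < τ ω} := by
  have h : {ω | T ω ≤ (t : ℕ∞) ∧ (t : ℕ∞) < τ ω}
      = {ω | T ω ≤ (t : ℕ∞)} ∩ {ω | τ ω ≤ (t : ℕ∞)}ᶜ := by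
    ext ω; simp
  rw [h]
  exact (hT t).inter (hτ t).compl

theorem measurableSet_eq_time {T : Ω → ℕ∞} (hT : IsStoppingTime ℱ T) (t : ℕ) :
    MeasurableSet[ℱ t] {ω | T ω = (t : ℕ∞)} :=
  hT.measurableSet_eq_of_countable t

/-- A process that loses at least `r` on average in each step between the stopping times `T` and `τ`
bounds the expected delay of `τ` after `T`. -/
theorem mul_lintegral_stoppingTime_le {T τ : Ω → ℕ∞} (hT : IsStoppingTime ℱ T)
    (hτ : IsStoppingTime ℱ τ) {U : ℕ → Ω → ℝ≥0∞} {r : ℝ≥0∞}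
    (hstep : ∀ t E, MeasurableSet[ℱ t] E → (∀ ω ∈ E, T ω ≤ (t : ℕ∞) ∧ (t : ℕ∞) < τ ω) →
      ∫⁻ ω in E, U (t + 1) ω ∂P + r * P E ≤ ∫⁻ ω in E, U t ω ∂P) :
    r * ∫⁻ ω, (τ ω : ℝ≥0∞) ∂P ≤
      r * ∫⁻ ω, (T ω : ℝ≥0∞) ∂P + ∑' t : ℕ, ∫⁻ ω in {ω | T ω = (t : ℕ∞)}, U t ω ∂P := by
  set E : ℕ → Set Ω := fun t => {ω | T ω ≤ (t : ℕ∞) ∧ (t : ℕ∞) < τ ω}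
  have hE : ∀ t, MeasurableSet[ℱ t] (E t) := measurableSet_le_inter_lt hT hτ
  have hEm : ∀ t, MeasurableSet (E t) := fun t => ℱ.le t _ (hE t)
  have hind : ∀ n : ℕ, ∫⁻ ω in E n, U n ω ∂P + ∑ t ∈ Finset.range n, r * P (E t) ≤
      ∑ t ∈ Finset.range (n + 1), ∫⁻ ω in {ω | T ω = (t : ℕ∞)}, U t ω ∂P := by
    intro n
    induction n with
    | zero =>
      simp only [Finset.range_zero, Finset.sum_empty, add_zero, zero_add, Finset.range_one,
        Finset.sum_singleton]
      refine lintegral_mono_set fun ω hω => ?_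
      have h : T ω ≤ ((0 : ℕ) : ℕ∞) := hω.1
      exact le_antisymm h (by simp)
    | succ n ih =>
      rw [Finset.sum_range_succ _ (n + 1), Finset.sum_range_succ]
      -- A path active at time `n + 1` was already active at `n`, or starts now with `T = n + 1`;
      -- new starters bring in their own initial value of `U`.
      have hsub : E (n + 1) ⊆ E n ∪ {ω | T ω = ((n + 1 : ℕ) : ℕ∞)} := by
        intro ω hω
        rcases hω.1.lt_or_eq with h | h
        · refine Or.inl ⟨?_, lt_of_le_of_lt (by exact_mod_cast Nat.le_succ n) hω.2⟩
          rw [Nat.cast_add, Nat.cast_one] at h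
          exact (ENat.lt_add_one_iff (ENat.natCast_ne_top n)).1 h
        · exact Or.inr h
      calc ∫⁻ ω in E (n + 1), U (n + 1) ω ∂P
            + (∑ t ∈ Finset.range n, r * P (E t) + r * P (E n))
          ≤ (∫⁻ ω in E n, U (n + 1) ω ∂P
              + ∫⁻ ω in {ω | T ω = ((n + 1 : ℕ) : ℕ∞)}, U (n + 1) ω ∂P)
            + (∑ t ∈ Finset.range n, r * P (E t) + r * P (E n)) := by
            gcongr
            exact (lintegral_mono_set hsub).trans (lintegral_union_le _ _ _)
        _ = (∫⁻ ω in E n, U (n + 1) ω ∂P + r * P (E n))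
            + ∑ t ∈ Finset.range n, r * P (E t)
            + ∫⁻ ω in {ω | T ω = ((n + 1 : ℕ) : ℕ∞)}, U (n + 1) ω ∂P := by ring
        _ ≤ _ := by
            gcongr
            refine le_trans ?_ ih
            gcongr
            exact hstep n _ (hE n) fun ω hω => hω
  have hsum : ∑' t : ℕ, r * P (E t) ≤
      ∑' t : ℕ, ∫⁻ ω in {ω | T ω = (t : ℕ∞)}, U t ω ∂P := by
    rw [ENNReal.tsum_eq_iSup_nat]
    refine iSup_le fun n => (le_add_self.trans (hind n)).trans ?_
    exact ENNReal.sum_le_tsum _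
  have hτE : ∫⁻ ω, (τ ω : ℝ≥0∞) ∂P ≤ ∫⁻ ω, (T ω : ℝ≥0∞) ∂P + ∑' t, P (E t) := by
    have h1 : ∀ t, Measurable ((E t).indicator fun _ => (1 : ℝ≥0∞)) := fun t =>
      measurable_const.indicator (hEm t)
    have h2 : ∑' t, P (E t) = ∫⁻ ω, ∑' t, (E t).indicator (fun _ => (1 : ℝ≥0∞)) ω ∂P := by
      rw [lintegral_tsum fun t => (h1 t).aemeasurable]
      exact tsum_congr fun t => (lintegral_indicator_one (hEm t)).symm
    rw [h2, ← lintegral_add_right _ (Measurable.tsum h1)]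
    refine lintegral_mono fun ω => (toENNReal_le_add_tsum (T ω) (τ ω)).trans (le_of_eq ?_)
    congr 1
    refine tsum_congr fun t => ?_
    by_cases h : ω ∈ E t
    · rw [Set.indicator_of_mem h]; exact if_pos h
    · rw [Set.indicator_of_notMem h]; exact if_neg h
  calc r * ∫⁻ ω, (τ ω : ℝ≥0∞) ∂P ≤ r * (∫⁻ ω, (T ω : ℝ≥0∞) ∂P + ∑' t, P (E t)) := by gcongr
    _ = r * ∫⁻ ω, (T ω : ℝ≥0∞) ∂P + ∑' t, r * P (E t) := by rw [mul_add, ENNReal.tsum_mul_left]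
    _ ≤ _ := by gcongr

theorem tsum_measure_eq_time_inter_le (P : Measure Ω) {T : Ω → ℕ∞} (hT : IsStoppingTime ℱ T)
    {F : Set Ω} (hF : MeasurableSet F) :
    ∑' t : ℕ, P ({ω | T ω = (t : ℕ∞)} ∩ F) ≤ P F := by
  rw [← measure_iUnion (fun s t hst => Set.disjoint_left.2 fun ω hs ht => hst ?_)
    fun t => (ℱ.le t _ (measurableSet_eq_time hT t)).inter hF]
  · exact measure_mono (Set.iUnion_subset fun _ => Set.inter_subset_right)
  · exact_mod_cast hs.1.symm.trans ht.1

end StoppingTime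

/-! ### Drift and second moments of the pairwise differences. -/

section Drift

variable {K : ℕ} {𝒳 : Fin K → Type*} [∀ k, MeasurableSpace (𝒳 k)]

/-- The pairs of a stream with signal and a stream without signal. -/
def signalPairs (A : Finset (Fin K)) : Finset (Fin K × Fin K) := A ×ˢ Aᶜ

theorem mem_signalPairs {A : Finset (Fin K)} {p : Fin K × Fin K} :
    p ∈ signalPairs A ↔ p.1 ∈ A ∧ p.2 ∉ A := by
  simp [signalPairs]

/-- The distance to `b` of the difference of the log-likelihood ratios of two streams. -/
noncomputable def deficit (S : Streams K 𝒳) (b : ℝ) (t : ℕ) (ω : Path 𝒳) (p : Fin K × Fin K) : ℝ :=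
  b - (LLR S t ω p.1 - LLR S t ω p.2)

/-- The increment at time `t + 1` of the difference of the log-likelihood ratios. -/
noncomputable def pairStep (S : Streams K 𝒳) (t : ℕ) (p : Fin K × Fin K) (ω : Path 𝒳) : ℝ :=
  obsLLR S p.1 (ω p.1 t) - obsLLR S p.2 (ω p.2 t)

theorem deficit_succ (S : Streams K 𝒳) (b : ℝ) (t : ℕ) (ω : Path 𝒳) (p : Fin K × Fin K) :
    deficit S b (t + 1) ω p = deficit S b t ω p - pairStep S t p ω := by
  simp only [deficit, pairStep, LLR_eq_sum, Finset.sum_range_succ]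
  ring

theorem memLp_obsLLR_coord {S : Streams K 𝒳} (hS : KLPosSecondMoment S) (A : Finset (Fin K))
    (k : Fin K) (s : ℕ) : MemLp (fun ω : Path 𝒳 => obsLLR S k (ω k s)) 2 (jointLaw S A) :=
  (memLp_obsLLR hS k (hyp A k)).comp_measurePreserving (measurePreserving_coord S A k s)

theorem memLp_pairStep {S : Streams K 𝒳} (hS : KLPosSecondMoment S) (A : Finset (Fin K)) (t : ℕ)
    (p : Fin K × Fin K) : MemLp (pairStep S t p) 2 (jointLaw S A) :=
  (memLp_obsLLR_coord hS A p.1 t).sub (memLp_obsLLR_coord hS A p.2 t)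

theorem measurable_pairStep (S : Streams K 𝒳) (t : ℕ) (p : Fin K × Fin K) :
    Measurable[MeasurableSpace.comap (obs (𝒳 := 𝒳) t) inferInstance] (pairStep S t p) := by
  have h : Measurable fun x : (k : Fin K) → 𝒳 k => obsLLR S p.1 (x p.1) - obsLLR S p.2 (x p.2) :=
    ((measurable_obsLLR S p.1).comp (measurable_pi_apply _)).sub
      ((measurable_obsLLR S p.2).comp (measurable_pi_apply _))
  exact h.comp (comap_measurable (obs (𝒳 := 𝒳) t))

theorem measurable_deficit (S : Streams K 𝒳) (b : ℝ) (t : ℕ) (p : Fin K × Fin K) :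
    Measurable[obsFiltration 𝒳 t] fun ω => deficit S b t ω p :=
  Measurable.const_sub (Measurable.sub ((measurable_pi_apply p.1).comp (measurable_LLR S t))
    ((measurable_pi_apply p.2).comp (measurable_LLR S t))) b

theorem integrable_LLR {S : Streams K 𝒳} (hS : KLPosSecondMoment S) (A : Finset (Fin K)) (t : ℕ)
    (k : Fin K) : Integrable (fun ω => LLR S t ω k) (jointLaw S A) :=
  integrable_finsetSum _ fun s _ => (memLp_obsLLR_coord hS A k s).integrable (by norm_num)

theorem integrable_deficit {S : Streams K 𝒳} (hS : KLPosSecondMoment S) (A : Finset (Fin K))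
    (b : ℝ) (t : ℕ) (p : Fin K × Fin K) :
    Integrable (fun ω => deficit S b t ω p) (jointLaw S A) :=
  (integrable_const b).sub ((integrable_LLR hS A t p.1).sub (integrable_LLR hS A t p.2))

theorem integral_obsLLR_coord (S : Streams K 𝒳) (A : Finset (Fin K)) (k : Fin K) (s : ℕ)
    {φ : ℝ → ℝ} (hφ : Measurable φ) :
    ∫ ω, φ (obsLLR S k (ω k s)) ∂(jointLaw S A)
      = ∫ x, φ (obsLLR S k x) ∂(obsLaw S k (hyp A k)) := by
  rw [← (measurePreserving_coord S A k s).map_eq]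
  exact (integral_map (measurable_coord k s).aemeasurable
    (hφ.comp (measurable_obsLLR S k)).aestronglyMeasurable).symm

/-- The drift of the difference of the log-likelihood ratios of two streams. -/
noncomputable def pairDrift (S : Streams K 𝒳) (A : Finset (Fin K)) (p : Fin K × Fin K) : ℝ :=
  ∫ x, obsLLR S p.1 x ∂(obsLaw S p.1 (hyp A p.1)) - ∫ x, obsLLR S p.2 x ∂(obsLaw S p.2 (hyp A p.2))

theorem integral_pairStep {S : Streams K 𝒳} (hS : KLPosSecondMoment S) (A : Finset (Fin K))
    (t : ℕ) (p : Fin K × Fin K) :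
    ∫ ω, pairStep S t p ω ∂(jointLaw S A) = pairDrift S A p := by
  unfold pairStep pairDrift
  rw [integral_sub ((memLp_obsLLR_coord hS A p.1 t).integrable (by norm_num))
    ((memLp_obsLLR_coord hS A p.2 t).integrable (by norm_num))]
  exact congrArg₂ _ (integral_obsLLR_coord S A p.1 t measurable_id)
    (integral_obsLLR_coord S A p.2 t measurable_id)

/-- The drift is the sum of two Kullback-Leibler divergences, of `f₁` from `f₀` in the signal stream
and of `f₀` from `f₁` in the other. -/
theorem pairDrift_pos {S : Streams K 𝒳} (hS : KLPosSecondMoment S) {A : Finset (Fin K)}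
    {p : Fin K × Fin K} (hp : p ∈ signalPairs A) : 0 < pairDrift S A p := by
  obtain ⟨h1, h2⟩ := mem_signalPairs.1 hp
  have h1' := integral_obsLLR_one_pos hS p.1
  have h2' := integral_obsLLR_zero_neg hS p.2
  simp only [pairDrift, hyp, h1, h2, if_true, if_false]
  linarith

theorem exists_pos_le_pairDrift {S : Streams K 𝒳} (hS : KLPosSecondMoment S)
    (A : Finset (Fin K)) : ∃ r > 0, ∀ p ∈ signalPairs A, r ≤ pairDrift S A p := by
  rcases (signalPairs A).eq_empty_or_nonempty with h | h
  · exact ⟨1, one_pos, by simp [h]⟩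
  · obtain ⟨q, hq, hmin⟩ := (signalPairs A).exists_min_image (pairDrift S A) h
    exact ⟨_, pairDrift_pos hS hq, hmin⟩

theorem exists_sum_integral_pairStep_sq_le {S : Streams K 𝒳} (hS : KLPosSecondMoment S)
    (A : Finset (Fin K)) : ∃ σ ≥ 0, ∀ t : ℕ,
      ∑ p ∈ signalPairs A, ∫ ω, pairStep S t p ω ^ 2 ∂(jointLaw S A) ≤ σ := by
  let v : Fin K → ℝ := fun k => ∫ x, obsLLR S k x ^ 2 ∂(obsLaw S k (hyp A k))
  have hv : ∀ k, 0 ≤ v k := fun k => integral_nonneg fun _ => sq_nonneg _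
  refine ⟨∑ p ∈ signalPairs A, (2 * v p.1 + 2 * v p.2),
    Finset.sum_nonneg fun p _ => by linarith [hv p.1, hv p.2],
    fun t => Finset.sum_le_sum fun p _ => ?_⟩
  have hi : ∀ k, Integrable (fun ω : Path 𝒳 => obsLLR S k (ω k t) ^ 2) (jointLaw S A) :=
    fun k => (memLp_obsLLR_coord hS A k t).integrable_sq
  have he : ∀ k, v k = ∫ ω, obsLLR S k (ω k t) ^ 2 ∂(jointLaw S A) := fun k =>
    (integral_obsLLR_coord S A k t (φ := fun x => x ^ 2) (measurable_id.pow_const 2)).symm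
  rw [he, he, ← integral_const_mul, ← integral_const_mul,
    ← integral_add ((hi _).const_mul _) ((hi _).const_mul _)]
  refine integral_mono (memLp_pairStep hS A t p).integrable_sq
    (((hi _).const_mul _).add ((hi _).const_mul _)) fun ω => ?_
  simp only [pairStep]
  nlinarith [sq_nonneg (obsLLR S p.1 (ω p.1 t) + obsLLR S p.2 (ω p.2 t))]

/-- The constants are chosen before `b` and `t`: this uniformity is what keeps the final bound
independent of `α`. -/
theorem exists_setLIntegral_posNorm_deficit_succ_le {S : Streams K 𝒳} (hS : KLPosSecondMoment S)
    (A : Finset (Fin K)) : ∃ r > 0, ∃ c > 0, ∀ (b : ℝ) (t : ℕ) (E : Set (Path 𝒳)),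
      MeasurableSet[obsFiltration 𝒳 t] E →
      (∀ ω ∈ E, c ≤ posNorm (signalPairs A) (deficit S b t ω)) →
      ∫⁻ ω in E, ENNReal.ofReal (posNorm (signalPairs A) (deficit S b (t + 1) ω)) ∂(jointLaw S A)
          + ENNReal.ofReal r * jointLaw S A E ≤
        ∫⁻ ω in E, ENNReal.ofReal (posNorm (signalPairs A) (deficit S b t ω)) ∂(jointLaw S A) := by
  obtain ⟨r, hr, hr'⟩ := exists_pos_le_pairDrift hS A
  obtain ⟨σ, hσ, hσ'⟩ := exists_sum_integral_pairStep_sq_le hS A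
  have hc : 0 < σ / r + 1 := by positivity
  -- With `c = σ / r + 1` the second-order term `σ / (2 * c)` is at most `r / 2`, leaving half of
  -- the drift.
  refine ⟨r / 2, half_pos hr, σ / r + 1, hc, fun b t E hE hEc => ?_⟩
  have hdm : ∀ t p, Measurable fun ω => deficit S b t ω p := fun t p =>
    (measurable_deficit S b t p).mono ((obsFiltration 𝒳).le t) le_rfl
  have hU : ∀ t, IntegrableOn (fun ω => posNorm (signalPairs A) (deficit S b t ω)) E
      (jointLaw S A) := fun t =>
    (integrable_posNorm (signalPairs A) (hdm t) (integrable_deficit hS A b t)).integrableOn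
  have hnn : ∀ t, 0 ≤ᵐ[(jointLaw S A).restrict E]
      fun ω => posNorm (signalPairs A) (deficit S b t ω) := fun t =>
    Eventually.of_forall fun _ => posNorm_nonneg _ _
  have key := setIntegral_posNorm_sub_le ((obsFiltration 𝒳).le t) (measurable_obs t).comap_le
    (indep_obsFiltration_obs S A t) (signalPairs A) (measurable_deficit S b t)
    (integrable_deficit hS A b t) (measurable_pairStep S t) (memLp_pairStep hS A t) hr.le
    (fun p hp => (integral_pairStep hS A t p).symm ▸ hr' p hp) hc hE hEc
  simp_rw [← deficit_succ] at key
  have hhalf : r / 2 ≤ r - (∑ p ∈ signalPairs A, ∫ ω, pairStep S t p ω ^ 2 ∂(jointLaw S A))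
      / (2 * (σ / r + 1)) := by
    have h1 : (∑ p ∈ signalPairs A, ∫ ω, pairStep S t p ω ^ 2 ∂(jointLaw S A))
        / (2 * (σ / r + 1)) ≤ r / 2 := by
      rw [div_le_iff₀ (by positivity)]
      have h2 : r / 2 * (2 * (σ / r + 1)) = σ + r := by field_simp
      linarith [hσ' t]
    linarith
  have hP : 0 ≤ (jointLaw S A).real E := measureReal_nonneg
  have hfin : ∫ ω in E, posNorm (signalPairs A) (deficit S b (t + 1) ω) ∂(jointLaw S A)
      + r / 2 * (jointLaw S A).real E
      ≤ ∫ ω in E, posNorm (signalPairs A) (deficit S b t ω) ∂(jointLaw S A) := by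
    have := mul_le_mul_of_nonneg_right hhalf hP
    linarith
  rw [← ofReal_integral_eq_lintegral_ofReal (hU _) (hnn _),
    ← ofReal_integral_eq_lintegral_ofReal (hU _) (hnn _), ← ofReal_measureReal,
    ← ENNReal.ofReal_mul (half_pos hr).le,
    ← ENNReal.ofReal_add (integral_nonneg fun _ => posNorm_nonneg _ _) (by positivity)]
  exact ENNReal.ofReal_le_ofReal hfin

end Drift

/-! ### Order statistics and the ordering of signals against non-signals. -/

section Gap

variable {K m : ℕ}

theorem le_gap {hm : 1 ≤ m} {hmK : m < K} {v : Fin K → ℝ} {A : Finset (Fin K)} (hA : A.card = m)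
    {b : ℝ} (hb : 0 < b) (h : ∀ j ∈ A, ∀ i ∉ A, b ≤ v j - v i) : b ≤ gap hm hmK v := by
  set σ := Tuple.sort v
  have hσ : Monotone (v ∘ σ) := Tuple.monotone_sort v
  -- Since `b > 0`, every signal is sorted strictly above every non-signal.
  have hlt : ∀ x y, σ x ∈ A → σ y ∉ A → y < x := fun x y hx hy => by
    by_contra hxy
    have h1 : v (σ x) ≤ v (σ y) := hσ (not_lt.1 hxy)
    linarith [h _ hx _ hy]
  refine h _ ?_ _ ?_
  -- A non-signal in position `K - m` would leave only `m - 1` positions for the `m` signals.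
  -- Dually, a signal in position `K - m - 1` would leave too few for the non-signals.
  · by_contra hp
    have hsub : A ⊆ (Finset.Ioi (⟨K - m, by omega⟩ : Fin K)).map σ.toEmbedding := fun a ha => by
      rw [Finset.mem_map_equiv, Finset.mem_Ioi]
      exact hlt _ _ (by simpa using ha) hp
    have := Finset.card_le_card hsub
    rw [Finset.card_map, Fin.card_Ioi, hA] at this
    dsimp only at this
    omega
  · intro hq
    have hsub : Aᶜ ⊆ (Finset.Iio (⟨K - m - 1, by omega⟩ : Fin K)).map σ.toEmbedding := fun a ha => by
      rw [Finset.mem_map_equiv, Finset.mem_Iio]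
      exact hlt _ _ hq (by simpa using ha)
    have := Finset.card_le_card hsub
    rw [Finset.card_map, Fin.card_Iio, Finset.card_compl, Fintype.card_fin, hA] at this
    dsimp only at this
    omega

/-- A wrong set of the right size contains an intruder and misses a signal; these two are sorted on
opposite sides of the gap. -/
theorem exists_sub_le_neg_of_topSet_ne {hm : 1 ≤ m} {hmK : m < K} {v : Fin K → ℝ}
    {A : Finset (Fin K)} (hA : A.card = m) {b : ℝ} (hb : b ≤ gap hm hmK v)
    (h : topSet hm hmK v ≠ A) : ∃ p ∈ signalPairs A, v p.1 - v p.2 ≤ -b := by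
  have hσ : Monotone (v ∘ Tuple.sort v) := Tuple.monotone_sort v
  have hcard : (topSet hm hmK v).card = A.card := (card_topSet hm hmK v).trans hA.symm
  obtain ⟨i, hi, hiA⟩ := Finset.not_subset.1 fun hsub =>
    h (Finset.eq_of_subset_of_card_le hsub hcard.ge)
  obtain ⟨j, hjA, hj⟩ := Finset.not_subset.1 fun hsub =>
    h (Finset.eq_of_subset_of_card_le hsub hcard.le).symm
  refine ⟨(j, i), mem_signalPairs.2 ⟨hjA, hiA⟩, ?_⟩
  rw [topSet, Finset.mem_map_equiv, Finset.mem_Ici] at hi hj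
  have h1 := hσ hi
  have h2 : (Tuple.sort v).symm j ≤ ⟨K - m - 1, by omega⟩ := by
    rw [not_le, Fin.lt_def] at hj
    rw [Fin.le_def]
    dsimp only at hj ⊢
    omega
  have h2' := hσ h2
  simp only [Function.comp_apply, Equiv.apply_symm_apply] at h1 h2'
  have h3 : gap hm hmK v = v (Tuple.sort v ⟨K - m, by omega⟩)
    - v (Tuple.sort v ⟨K - m - 1, by omega⟩) := rfl
  dsimp only
  linarith

theorem card_signalPairs {A : Finset (Fin K)} (hA : A.card = m) :
    (signalPairs A).card = m * (K - m) := by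
  rw [signalPairs, Finset.card_product, Finset.card_compl, Fintype.card_fin, hA]

theorem card_insert_erase {A : Finset (Fin K)} (hA : A.card = m) {p : Fin K × Fin K}
    (hp : p ∈ signalPairs A) : (insert p.2 (A.erase p.1)).card = m := by
  obtain ⟨h1, h2⟩ := mem_signalPairs.1 hp
  rw [Finset.card_insert_of_notMem fun h => h2 (Finset.mem_of_mem_erase h),
    Finset.card_erase_add_one h1, hA]

end Gap

/-! ### Expected delay, error probability, and the deficit left by a competing procedure. -/

section GapTime

variable {K m : ℕ} {𝒳 : Fin K → Type*} [∀ k, MeasurableSpace (𝒳 k)]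

theorem gap_lt_of_lt_gapTime {S : Streams K 𝒳} {hm : 1 ≤ m} {hmK : m < K} {b : ℝ} {ω : Path 𝒳}
    {t : ℕ} (ht : 1 ≤ t) (h : (t : ℕ∞) < gapTime S hm hmK b ω) :
    gap hm hmK (LLR S t ω) < b := by
  by_contra hb
  exact absurd (iInf₂_le t ⟨ht, not_lt.1 hb⟩) h.not_ge

theorem le_gap_of_gapTime_eq {S : Streams K 𝒳} {hm : 1 ≤ m} {hmK : m < K} {b : ℝ} {ω : Path 𝒳}
    {t : ℕ} (h : gapTime S hm hmK b ω = (t : ℕ∞)) : b ≤ gap hm hmK (LLR S t ω) := by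
  have h1 : gapTime S hm hmK b ω < ((t + 1 : ℕ) : ℕ∞) := by
    rw [h]; exact_mod_cast Nat.lt_succ_self t
  simp only [gapTime, iInf_lt_iff] at h1
  obtain ⟨s, hs, hst⟩ := h1
  have h2 : (t : ℕ∞) ≤ s := h ▸ iInf₂_le s hs
  have hts : t ≤ s := by exact_mod_cast h2
  have hst' : s < t + 1 := by exact_mod_cast hst
  obtain rfl : s = t := by omega
  exact hs.2

/-- Before the Gap rule stops some pair has difference below `b`. Measuring deficits from `b + c`
then keeps the norm above `c`, where the drift estimate applies. -/
theorem exists_mul_lintegral_gapTime_le {S : Streams K 𝒳} (hS : KLPosSecondMoment S)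
    (hm : 1 ≤ m) (hmK : m < K) {A : Finset (Fin K)} (hA : A.card = m) :
    ∃ r > 0, ∃ c > 0, ∀ b > 0, ∀ T : Path 𝒳 → ℕ∞, IsStoppingTime (obsFiltration 𝒳) T →
      (∀ ω, 1 ≤ T ω) →
      ENNReal.ofReal r * ∫⁻ ω, (gapTime S hm hmK b ω : ℝ≥0∞) ∂(jointLaw S A) ≤
        ENNReal.ofReal r * ∫⁻ ω, (T ω : ℝ≥0∞) ∂(jointLaw S A)
          + ∑' t : ℕ, ∫⁻ ω in {ω | T ω = (t : ℕ∞)},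
            ENNReal.ofReal (posNorm (signalPairs A) (deficit S (b + c) t ω)) ∂(jointLaw S A) := by
  obtain ⟨r, hr, c, hc, h⟩ := exists_setLIntegral_posNorm_deficit_succ_le hS A
  refine ⟨r, hr, c, hc, fun b hb T hT hT1 => ?_⟩
  refine mul_lintegral_stoppingTime_le hT (gapTime_isStoppingTime S hm hmK b)
    (U := fun t ω => ENNReal.ofReal (posNorm (signalPairs A) (deficit S (b + c) t ω)))
    fun t E hE hEt => h (b + c) t E hE fun ω hω => ?_
  have ht : 1 ≤ t := by exact_mod_cast (hT1 ω).trans (hEt ω hω).1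
  have hgap := gap_lt_of_lt_gapTime ht (hEt ω hω).2
  have : ∃ p ∈ signalPairs A, LLR S t ω p.1 - LLR S t ω p.2 < b := by
    by_contra! hcon
    exact absurd (le_gap hA hb fun j hj i hi => hcon (j, i) (mem_signalPairs.2 ⟨hj, hi⟩)) hgap.not_ge
  obtain ⟨p, hp, hpb⟩ := this
  refine le_trans ?_ (max_le_posNorm (deficit S (b + c) t ω) hp)
  refine le_max_of_le_left ?_
  simp only [deficit]
  linarith

theorem lintegral_gapTime_lt_top {S : Streams K 𝒳} (hS : KLPosSecondMoment S)
    (hm : 1 ≤ m) (hmK : m < K) {A : Finset (Fin K)} (hA : A.card = m) {b : ℝ} (hb : 0 < b) :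
    ∫⁻ ω, (gapTime S hm hmK b ω : ℝ≥0∞) ∂(jointLaw S A) < ∞ := by
  obtain ⟨r, hr, c, _, h⟩ := exists_mul_lintegral_gapTime_le hS hm hmK hA
  -- The constant time `1` serves as starting point, where the norm is integrable.
  have h1 := h b hb (fun _ => ((1 : ℕ) : ℕ∞)) (isStoppingTime_const _ 1) (fun _ => le_rfl)
  have hint : Integrable (fun ω => posNorm (signalPairs A) (deficit S (b + c) 1 ω))
      (jointLaw S A) :=
    integrable_posNorm (signalPairs A)
      (fun p => (measurable_deficit S (b + c) 1 p).mono ((obsFiltration 𝒳).le 1) le_rfl)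
      (integrable_deficit hS A (b + c) 1)
  have hfin : ∫⁻ ω, ENNReal.ofReal (posNorm (signalPairs A) (deficit S (b + c) 1 ω))
      ∂(jointLaw S A) ≠ ∞ := by
    rw [← ofReal_integral_eq_lintegral_ofReal hint (Eventually.of_forall fun _ => posNorm_nonneg _ _)]
    exact ENNReal.ofReal_ne_top
  rw [tsum_eq_single 1 fun t ht => by
    have : ({_ω : Path 𝒳 | ((1 : ℕ) : ℕ∞) = (t : ℕ∞)}) = ∅ := by
      ext ω; simpa using fun h : (1 : ℕ∞) = t => ht (by exact_mod_cast h.symm)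
    rw [this]; simp] at h1
  have hr' : ENNReal.ofReal r ≠ 0 := by simpa using hr
  refine lt_top_iff_ne_top.2 fun htop => ?_
  rw [htop, ENNReal.mul_top hr', top_le_iff] at h1
  refine absurd h1 (ENNReal.add_ne_top.2 ⟨?_, ?_⟩)
  · rw [lintegral_const, measure_univ]
    exact ENNReal.mul_ne_top ENNReal.ofReal_ne_top (by simp)
  · exact ne_top_of_le_ne_top hfin (setLIntegral_le_lintegral _ _)

theorem measurableSet_time_eq_top {T : Path 𝒳 → ℕ∞} (hT : IsStoppingTime (obsFiltration 𝒳) T) :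
    MeasurableSet {ω | T ω = ⊤} := by
  have h : {ω | T ω = ⊤} = (⋃ t : ℕ, {ω | T ω = (t : ℕ∞)})ᶜ := by
    ext ω
    simp only [Set.mem_ofPred_eq, Set.mem_compl_iff, Set.mem_iUnion]
    rw [← not_iff_not, not_not, ← ne_eq, ENat.ne_top_iff_exists]
    exact exists_congr fun _ => eq_comm
  rw [h]
  exact (MeasurableSet.iUnion fun t =>
    (obsFiltration 𝒳).le t _ (measurableSet_eq_time hT t)).compl

theorem measure_time_eq_top {P : Measure (Path 𝒳)} {T : Path 𝒳 → ℕ∞}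
    (hT : IsStoppingTime (obsFiltration 𝒳) T) (hfin : ∫⁻ ω, (T ω : ℝ≥0∞) ∂P < ∞) :
    P {ω | T ω = ⊤} = 0 := by
  by_contra h0
  have h : ∫⁻ ω in {ω | T ω = ⊤}, (T ω : ℝ≥0∞) ∂P = ∞ := by
    rw [setLIntegral_congr_fun (g := fun _ => ∞) (measurableSet_time_eq_top hT) fun ω hω => by
      have : T ω = ⊤ := hω
      simp [this]]
    rw [setLIntegral_const, ENNReal.top_mul h0]
  exact absurd hfin (top_le_iff.1 (h ▸ setLIntegral_le_lintegral _ _)).not_lt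

/-- Change of measure between two signal subsets that differ in one pair of streams. -/
theorem setLIntegral_exp_neg_sub {S : Streams K 𝒳} (hS : KLPosSecondMoment S)
    {A : Finset (Fin K)} {p : Fin K × Fin K} (hp : p ∈ signalPairs A) (t : ℕ) {E : Set (Path 𝒳)}
    (hE : MeasurableSet[obsFiltration 𝒳 t] E) :
    ∫⁻ ω in E, ENNReal.ofReal (Real.exp (-(LLR S t ω p.1 - LLR S t ω p.2))) ∂(jointLaw S A)
      = jointLaw S (insert p.2 (A.erase p.1)) E := by
  obtain ⟨h1, h2⟩ := mem_signalPairs.1 hp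
  rw [← setLIntegral_exp_jointLLR hS A _ t hE]
  simp_rw [jointLLR_insert_erase S h2 h1, neg_sub]

theorem jointLaw_gapDecision_ne_le {S : Streams K 𝒳} (hS : KLPosSecondMoment S)
    (hm : 1 ≤ m) (hmK : m < K) {A : Finset (Fin K)} (hA : A.card = m) {b : ℝ} (hb : 0 < b) :
    jointLaw S A {ω | gapDecision S hm hmK b ω ≠ A} ≤
      ((m * (K - m) : ℕ) : ℝ≥0∞) * ENNReal.ofReal (Real.exp (-b)) := by
  have hT := gapTime_isStoppingTime S hm hmK b
  set E : Fin K × Fin K → ℕ → Set (Path 𝒳) := fun p t =>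
    {ω | gapTime S hm hmK b ω = (t : ℕ∞)} ∩ {ω | LLR S t ω p.1 - LLR S t ω p.2 ≤ -b}
  have hE : ∀ p t, MeasurableSet[obsFiltration 𝒳 t] (E p t) := fun p t =>
    (measurableSet_eq_time hT t).inter (measurable_LLR S t (measurableSet_le
      ((measurable_pi_apply (X := fun _ : Fin K => ℝ) p.1).sub (measurable_pi_apply p.2))
      measurable_const))
  have hsub : {ω | gapDecision S hm hmK b ω ≠ A} ⊆ {ω | gapTime S hm hmK b ω = ⊤} ∪
      ⋃ p ∈ signalPairs A, ⋃ t : ℕ, E p t := by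
    intro ω hω
    -- On a path that never stops, `toNat` gives `0` and the decision is a default value; this event
    -- is null because the expected time is finite.
    by_cases htop : gapTime S hm hmK b ω = ⊤
    · exact Or.inl htop
    · right
      obtain ⟨t, ht⟩ := ENat.ne_top_iff_exists.1 htop
      have hω' : gapDecision S hm hmK b ω ≠ A := hω
      rw [gapDecision, ← ht, ENat.toNat_natCast] at hω'
      obtain ⟨p, hp, hpb⟩ := exists_sub_le_neg_of_topSet_ne hA (le_gap_of_gapTime_eq ht.symm) hω'
      exact Set.mem_iUnion₂.2 ⟨p, hp, Set.mem_iUnion.2 ⟨t, ht.symm, hpb⟩⟩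
  have hpt : ∀ p ∈ signalPairs A, ∀ t, jointLaw S A (E p t) ≤ ENNReal.ofReal (Real.exp (-b))
      * jointLaw S (insert p.2 (A.erase p.1)) ({ω | gapTime S hm hmK b ω = (t : ℕ∞)} ∩ Set.univ) := by
    intro p hp t
    have hEm := (obsFiltration 𝒳).le t _ (hE p t)
    have h1 : ENNReal.ofReal (Real.exp b) * jointLaw S A (E p t) ≤
        jointLaw S (insert p.2 (A.erase p.1)) (E p t) := by
      rw [← setLIntegral_exp_neg_sub hS hp t (hE p t), ← setLIntegral_const]
      refine setLIntegral_mono' hEm fun ω hω => ENNReal.ofReal_le_ofReal (Real.exp_le_exp.2 ?_)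
      have : LLR S t ω p.1 - LLR S t ω p.2 ≤ -b := hω.2
      linarith
    calc jointLaw S A (E p t)
        = ENNReal.ofReal (Real.exp (-b)) * (ENNReal.ofReal (Real.exp b) * jointLaw S A (E p t)) := by
          rw [← mul_assoc, ← ENNReal.ofReal_mul (Real.exp_pos _).le, ← Real.exp_add]
          simp
      _ ≤ _ := by
          gcongr
          exact h1.trans (measure_mono (Set.inter_subset_inter_right _ (Set.subset_univ _)))
  calc jointLaw S A {ω | gapDecision S hm hmK b ω ≠ A}
      ≤ jointLaw S A {ω | gapTime S hm hmK b ω = ⊤}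
        + ∑ p ∈ signalPairs A, jointLaw S A (⋃ t : ℕ, E p t) :=
        (measure_mono hsub).trans ((measure_union_le _ _).trans
          (add_le_add le_rfl (measure_biUnion_finset_le _ _)))
    _ ≤ 0 + ∑ p ∈ signalPairs A, ENNReal.ofReal (Real.exp (-b)) := by
        gcongr with p hp
        · exact (measure_time_eq_top hT (lintegral_gapTime_lt_top hS hm hmK hA hb)).le
        · refine (measure_iUnion_le _).trans ((ENNReal.tsum_le_tsum (hpt p hp)).trans ?_)
          rw [ENNReal.tsum_mul_left]
          refine mul_le_of_le_one_right' ?_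
          exact (tsum_measure_eq_time_inter_le _ hT MeasurableSet.univ).trans prob_le_one
    _ = _ := by rw [zero_add, Finset.sum_const, card_signalPairs hA, nsmul_eq_mul]

theorem ofReal_posNorm_deficit_le (S : Streams K 𝒳) (A : Finset (Fin K)) (b c : ℝ)
    (t : ℕ) (ω : Path 𝒳) :
    ENNReal.ofReal (posNorm (signalPairs A) (deficit S (b + c) t ω)) ≤
      ∑ p ∈ signalPairs A, (ENNReal.ofReal c + ENNReal.ofReal (deficit S b t ω p)) := by
  refine (ENNReal.ofReal_le_ofReal (posNorm_le_sum _ _)).trans ?_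
  rw [ENNReal.ofReal_sum_of_nonneg fun _ _ => le_max_right _ _]
  refine Finset.sum_le_sum fun p _ => ?_
  have h : deficit S (b + c) t ω p = c + deficit S b t ω p := by simp only [deficit]; ring
  rw [h, max_comm, ENNReal.ofReal_max, ENNReal.ofReal_zero, max_eq_right zero_le]
  exact ENNReal.ofReal_add_le

/-- A procedure that seldom errs under the swapped law cannot stop and declare `A` while `Z` is far
below `b`; the right-hand side stays bounded when `exp b` is of order `1 / α`. -/
theorem tsum_setLIntegral_deficit_le {S : Streams K 𝒳} (hS : KLPosSecondMoment S)
    {A : Finset (Fin K)} (hA : A.card = m) {p : Fin K × Fin K} (hp : p ∈ signalPairs A)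
    {α b : ℝ} (hb : 0 ≤ b) {δ : Procedure 𝒳 (knownNumber K m)} (hδ : δ ∈ knsClass S m α) :
    ∑' t : ℕ, ∫⁻ ω in {ω | δ.T ω = (t : ℕ∞)}, ENNReal.ofReal (deficit S b t ω p) ∂(jointLaw S A) ≤
      ENNReal.ofReal (Real.exp b) * ENNReal.ofReal α
        + (ENNReal.ofReal b * ENNReal.ofReal α + 1) := by
  set B := insert p.2 (A.erase p.1)
  have hBA : A ≠ B := fun h => (mem_signalPairs.1 hp).2 (h ▸ Finset.mem_insert_self _ _)
  have hT := δ.isStoppingTime_T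
  set G : Set (Path 𝒳) := {ω | δ.D ω = A}
  have hG : MeasurableSet G := hT.measurableSpace_le _ (δ.measurable_D A)
  have hGt : ∀ t : ℕ, MeasurableSet[obsFiltration 𝒳 t] ({ω | δ.T ω = (t : ℕ∞)} ∩ G) := fun t => by
    rw [Set.inter_comm]
    exact (hT.measurableSet_inter_eq_iff _ t).1
      ((δ.measurable_D A).inter (hT.measurableSet_eq_of_countable' t))
  have hGct : ∀ t : ℕ, MeasurableSet[obsFiltration 𝒳 t] ({ω | δ.T ω = (t : ℕ∞)} ∩ Gᶜ) := fun t => by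
    have : {ω | δ.T ω = (t : ℕ∞)} ∩ Gᶜ
        = {ω | δ.T ω = (t : ℕ∞)} \ ({ω | δ.T ω = (t : ℕ∞)} ∩ G) := by
      ext ω; simp
    rw [this]
    exact (measurableSet_eq_time hT t).diff (hGt t)
  have hexp : ∀ t : ℕ, Measurable fun ω : Path 𝒳 =>
      ENNReal.ofReal (Real.exp (-(LLR S t ω p.1 - LLR S t ω p.2))) := fun t => by
    have h := (measurable_deficit S 0 t p).mono ((obsFiltration 𝒳).le t) le_rfl
    simp only [deficit, zero_sub] at h
    exact h.exp.ennreal_ofReal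
  -- Declaring `A` is an error under `B`.
  have hBle : jointLaw S B G ≤ ENNReal.ofReal α := by
    refine (measure_mono ?_).trans (hδ B (card_insert_erase hA hp))
    intro ω hω
    exact fun h => hBA ((show δ.D ω = A from hω).symm.trans h)
  have hAle : jointLaw S A Gᶜ ≤ ENNReal.ofReal α := hδ A hA
  have h1 : ∀ t : ℕ, ∫⁻ ω in {ω | δ.T ω = (t : ℕ∞)} ∩ G, ENNReal.ofReal (deficit S b t ω p)
      ∂(jointLaw S A) ≤ ENNReal.ofReal (Real.exp b) * jointLaw S B ({ω | δ.T ω = (t : ℕ∞)} ∩ G) := by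
    intro t
    rw [← setLIntegral_exp_neg_sub hS hp t (hGt t), ← lintegral_const_mul _ (hexp t)]
    refine lintegral_mono fun ω => ?_
    rw [← ENNReal.ofReal_mul (Real.exp_pos _).le, ← Real.exp_add]
    refine ENNReal.ofReal_le_ofReal ?_
    rw [← sub_eq_add_neg]
    have := Real.add_one_le_exp (deficit S b t ω p)
    simp only [deficit] at this ⊢
    linarith
  have h2 : ∀ t : ℕ, ∫⁻ ω in {ω | δ.T ω = (t : ℕ∞)} ∩ Gᶜ, ENNReal.ofReal (deficit S b t ω p)
      ∂(jointLaw S A) ≤ ENNReal.ofReal b * jointLaw S A ({ω | δ.T ω = (t : ℕ∞)} ∩ Gᶜ)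
        + jointLaw S B ({ω | δ.T ω = (t : ℕ∞)} ∩ Gᶜ) := by
    intro t
    rw [← setLIntegral_exp_neg_sub hS hp t (hGct t), ← setLIntegral_const,
      ← lintegral_add_left measurable_const]
    refine lintegral_mono fun ω => ?_
    rw [← ENNReal.ofReal_add hb (Real.exp_pos _).le]
    refine ENNReal.ofReal_le_ofReal ?_
    have := Real.add_one_le_exp (-(LLR S t ω p.1 - LLR S t ω p.2))
    simp only [deficit]
    linarith
  calc ∑' t : ℕ, ∫⁻ ω in {ω | δ.T ω = (t : ℕ∞)}, ENNReal.ofReal (deficit S b t ω p) ∂(jointLaw S A)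
      ≤ ∑' t : ℕ, (ENNReal.ofReal (Real.exp b) * jointLaw S B ({ω | δ.T ω = (t : ℕ∞)} ∩ G)
        + (ENNReal.ofReal b * jointLaw S A ({ω | δ.T ω = (t : ℕ∞)} ∩ Gᶜ)
        + jointLaw S B ({ω | δ.T ω = (t : ℕ∞)} ∩ Gᶜ))) := by
        refine ENNReal.tsum_le_tsum fun t => ?_
        refine le_trans ?_ (add_le_add (h1 t) (h2 t))
        rw [← Set.sdiff_eq, lintegral_inter_add_sdiff _ _ hG]
    _ = ENNReal.ofReal (Real.exp b) * ∑' t : ℕ, jointLaw S B ({ω | δ.T ω = (t : ℕ∞)} ∩ G)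
        + (ENNReal.ofReal b * ∑' t : ℕ, jointLaw S A ({ω | δ.T ω = (t : ℕ∞)} ∩ Gᶜ)
        + ∑' t : ℕ, jointLaw S B ({ω | δ.T ω = (t : ℕ∞)} ∩ Gᶜ)) := by
        rw [ENNReal.tsum_add, ENNReal.tsum_add, ENNReal.tsum_mul_left, ENNReal.tsum_mul_left]
    _ ≤ _ := by
        gcongr
        · exact (tsum_measure_eq_time_inter_le _ hT hG).trans hBle
        · exact (tsum_measure_eq_time_inter_le _ hT hG.compl).trans hAle
        · exact (tsum_measure_eq_time_inter_le _ hT hG.compl).trans prob_le_one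

end GapTime

/-! ### Arithmetic of the threshold. -/

section Threshold

variable {K m : ℕ}

theorem natCast_mul_sub (hmK : m < K) :
    ((m * (K - m) : ℕ) : ℝ) = (m : ℝ) * ((K : ℝ) - (m : ℝ)) := by
  push_cast [hmK.le]; ring

theorem one_le_mul_sub (hm : 1 ≤ m) (hmK : m < K) : (1 : ℝ) ≤ (m : ℝ) * ((K : ℝ) - (m : ℝ)) := by
  rw [← natCast_mul_sub hmK]
  exact_mod_cast Nat.mul_pos hm (Nat.sub_pos_of_lt hmK)

theorem abs_log_eq_neg {α : ℝ} (hα : α ∈ Set.Ioo (0 : ℝ) 1) : |Real.log α| = -Real.log α :=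
  abs_of_neg (Real.log_neg hα.1 hα.2)

theorem gapThreshold_pos (hm : 1 ≤ m) (hmK : m < K) {α : ℝ} (hα : α ∈ Set.Ioo (0 : ℝ) 1) :
    0 < gapThreshold K m α :=
  add_pos_of_pos_of_nonneg (abs_pos.2 (Real.log_neg hα.1 hα.2).ne)
    (Real.log_nonneg (one_le_mul_sub hm hmK))

theorem exp_gapThreshold_mul (hm : 1 ≤ m) (hmK : m < K) {α : ℝ} (hα : α ∈ Set.Ioo (0 : ℝ) 1) :
    Real.exp (gapThreshold K m α) * α = ((m * (K - m) : ℕ) : ℝ) := by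
  rw [gapThreshold, abs_log_eq_neg hα, Real.exp_add, Real.exp_neg, Real.exp_log hα.1,
    Real.exp_log (zero_lt_one.trans_le (one_le_mul_sub hm hmK)), natCast_mul_sub hmK]
  field_simp [hα.1.ne']

theorem mul_exp_neg_gapThreshold (hm : 1 ≤ m) (hmK : m < K) {α : ℝ}
    (hα : α ∈ Set.Ioo (0 : ℝ) 1) :
    ((m * (K - m) : ℕ) : ℝ) * Real.exp (-gapThreshold K m α) = α := by
  rw [← exp_gapThreshold_mul hm hmK hα, mul_right_comm, ← Real.exp_add]
  simp

/-- Since `α * |log α| ≤ 1`, a wrong decision of the competitor, although it may leave a deficit of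
order `b`, costs only a bounded amount on average. -/
theorem gapThreshold_mul_le (hm : 1 ≤ m) (hmK : m < K) {α : ℝ} (hα : α ∈ Set.Ioo (0 : ℝ) 1) :
    gapThreshold K m α * α ≤ 1 + Real.log ((m : ℝ) * ((K : ℝ) - (m : ℝ))) := by
  have h1 := Real.one_sub_inv_le_log_of_pos hα.1
  have h2 : |Real.log α| * α ≤ 1 := by
    rw [abs_log_eq_neg hα]
    have h3 := mul_le_mul_of_nonneg_right h1 hα.1.le
    rw [sub_mul, inv_mul_cancel₀ hα.1.ne'] at h3
    linarith [hα.1]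
  have h3 := mul_le_of_le_one_right (Real.log_nonneg (one_le_mul_sub hm hmK)) hα.2.le
  rw [gapThreshold, add_mul]
  linarith

end Threshold

/-! ### Second-order optimality. -/

section Optimality

variable {K m : ℕ} {𝒳 : Fin K → Type*} [∀ k, MeasurableSpace (𝒳 k)]

theorem gapRule_mem_knsClass {S : Streams K 𝒳} (hS : KLPosSecondMoment S) (hm : 1 ≤ m)
    (hmK : m < K) {α : ℝ} (hα : α ∈ Set.Ioo (0 : ℝ) 1) :
    gapRule S hm hmK (gapThreshold K m α) ∈ knsClass S m α := by
  intro A hA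
  refine (jointLaw_gapDecision_ne_le hS hm hmK hA (gapThreshold_pos hm hmK hα)).trans (le_of_eq ?_)
  rw [← ENNReal.ofReal_natCast, ← ENNReal.ofReal_mul (Nat.cast_nonneg _),
    mul_exp_neg_gapThreshold hm hmK hα]

/-- The expected sample size of the Gap rule exceeds that of any procedure in the class at most by a
constant. -/
theorem exists_ESS_gapRule_le_add {S : Streams K 𝒳} (hS : KLPosSecondMoment S) (hm : 1 ≤ m)
    (hmK : m < K) {A : Finset (Fin K)} (hA : A.card = m) :
    ∃ C : ℝ≥0∞, C ≠ ∞ ∧ ∀ α ∈ Set.Ioo (0 : ℝ) 1, ∀ δ ∈ knsClass S m α,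
      ESS S A (gapRule S hm hmK (gapThreshold K m α)) ≤ ESS S A δ + C := by
  obtain ⟨r, hr, c, hc, h⟩ := exists_mul_lintegral_gapTime_le hS hm hmK hA
  have hr0 : ENNReal.ofReal r ≠ 0 := by simpa using hr
  set L := ENNReal.ofReal (1 + Real.log ((m : ℝ) * ((K : ℝ) - (m : ℝ))))
  -- For each pair: `c` from the shifted level, `m (K - m) = exp b * α`, `L` as a bound of `b * α`,
  -- and `1` for the mass of the swapped law.
  set C' : ℝ≥0∞ := ∑ _p ∈ signalPairs A,
    (ENNReal.ofReal c + (((m * (K - m) : ℕ) : ℝ≥0∞) + (L + 1)))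
  have hC' : C' ≠ ∞ := by
    refine ENNReal.sum_ne_top.2 fun _ _ => ?_
    simp only [L, ne_eq, ENNReal.add_eq_top, ENNReal.ofReal_ne_top, ENNReal.natCast_ne_top,
      ENNReal.one_ne_top, or_self, not_false_eq_true]
  refine ⟨C' / ENNReal.ofReal r, ENNReal.div_ne_top hC' hr0, fun α hα δ hδ => ?_⟩
  set b := gapThreshold K m α
  have hb : 0 < b := gapThreshold_pos hm hmK hα
  have hT := δ.isStoppingTime_T
  have hdm : ∀ t p, Measurable fun ω => ENNReal.ofReal (deficit S b t ω p) := fun t p =>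
    ((measurable_deficit S b t p).mono ((obsFiltration 𝒳).le t) le_rfl).ennreal_ofReal
  have hsum : ∑' t : ℕ, ∫⁻ ω in {ω | δ.T ω = (t : ℕ∞)},
      ENNReal.ofReal (posNorm (signalPairs A) (deficit S (b + c) t ω)) ∂(jointLaw S A) ≤ C' := by
    calc ∑' t : ℕ, ∫⁻ ω in {ω | δ.T ω = (t : ℕ∞)},
          ENNReal.ofReal (posNorm (signalPairs A) (deficit S (b + c) t ω)) ∂(jointLaw S A)
        ≤ ∑' t : ℕ, ∑ p ∈ signalPairs A,
          (ENNReal.ofReal c * jointLaw S A ({ω | δ.T ω = (t : ℕ∞)} ∩ Set.univ)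
          + ∫⁻ ω in {ω | δ.T ω = (t : ℕ∞)}, ENNReal.ofReal (deficit S b t ω p)
            ∂(jointLaw S A)) := by
          refine ENNReal.tsum_le_tsum fun t => ?_
          refine (lintegral_mono fun ω => ofReal_posNorm_deficit_le S A b c t ω).trans (le_of_eq ?_)
          rw [lintegral_finsetSum _ fun p _ => (hdm t p).const_add _]
          refine Finset.sum_congr rfl fun p _ => ?_
          rw [lintegral_add_left measurable_const, setLIntegral_const, Set.inter_univ]
      _ = ∑ p ∈ signalPairs A,
          (ENNReal.ofReal c * ∑' t : ℕ, jointLaw S A ({ω | δ.T ω = (t : ℕ∞)} ∩ Set.univ)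
          + ∑' t : ℕ, ∫⁻ ω in {ω | δ.T ω = (t : ℕ∞)}, ENNReal.ofReal (deficit S b t ω p)
            ∂(jointLaw S A)) := by
          rw [Summable.tsum_finsetSum fun _ _ => ENNReal.summable]
          refine Finset.sum_congr rfl fun p _ => ?_
          rw [ENNReal.tsum_add, ENNReal.tsum_mul_left]
      _ ≤ C' := by
          refine Finset.sum_le_sum fun p hp => add_le_add ?_ ?_
          · exact mul_le_of_le_one_right'
              ((tsum_measure_eq_time_inter_le _ hT MeasurableSet.univ).trans prob_le_one)
          · refine (tsum_setLIntegral_deficit_le hS hA hp hb.le hδ).trans ?_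
            rw [← ENNReal.ofReal_mul (Real.exp_pos _).le, ← ENNReal.ofReal_mul hb.le,
              exp_gapThreshold_mul hm hmK hα, ENNReal.ofReal_natCast]
            gcongr
            exact ENNReal.ofReal_le_ofReal (gapThreshold_mul_le hm hmK hα)
  have h1 := (h b hb δ.T hT δ.one_le_T).trans (add_le_add le_rfl hsum)
  rw [← ENNReal.mul_le_mul_iff_right hr0 ENNReal.ofReal_ne_top, mul_add,
    ENNReal.mul_div_cancel hr0 ENNReal.ofReal_ne_top]
  exact h1

theorem secondOrderOptimal_gapRule {S : Streams K 𝒳} (hS : KLPosSecondMoment S) (hm : 1 ≤ m)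
    (hmK : m < K) :
    SecondOrderOptimal S (fun α => gapRule S hm hmK (gapThreshold K m α))
      (fun α => knsClass S m α) := by
  refine ⟨fun α hα => gapRule_mem_knsClass hS hm hmK hα, fun A hA => ⟨fun α hα =>
    lintegral_gapTime_lt_top hS hm hmK hA (gapThreshold_pos hm hmK hα), ?_⟩⟩
  obtain ⟨C, hC, h⟩ := exists_ESS_gapRule_le_add hS hm hmK (show A.card = m from hA)
  refine lt_of_le_of_lt (limsup_le_of_le (a := (C : EReal)) (h := ?_)) ?_
  · filter_upwards [Ioo_mem_nhdsGT (zero_lt_one (α := ℝ))] with α hα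
    refine EReal.sub_le_of_le_add ?_
    rw [← EReal.coe_ennreal_add, EReal.coe_ennreal_le_coe_ennreal_iff, add_comm]
    -- The bound holds for each competitor with the same constant, so it passes to the infimum.
    simp only [minESS, ENNReal.iInf_add]
    exact le_iInf₂ fun δ hδ => h α hα δ hδ
  · exact lt_top_iff_ne_top.2 (by simpa using hC)

end Optimality

end SeqTest

theorem mainTheorem8 {K m : ℕ} (hm : 1 ≤ m) (hmK : m < K)
    {𝒳 : Fin K → Type*} [∀ k, MeasurableSpace (𝒳 k)]
    (S : SeqTest.Streams K 𝒳) (hS : SeqTest.KLPosSecondMoment S) :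
    SeqTest.SecondOrderOptimal S
      (fun α => SeqTest.gapRule S hm hmK (SeqTest.gapThreshold K m α))
      (fun α => SeqTest.knsClass S m α) :=
  SeqTest.secondOrderOptimal_gapRule hS hm hmK
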